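/- Let $m,M,n$ be positive integers and let $f_j^i:\mathbb{R}^n\to\mathbb{R}$ ($1\le i\le M$, $1\le j\le m$) be differentiable functions. Put $f_j=\frac1M\sum_{i=1}^M f_j^i$ and $f=\frac1m\sum_{j=1}^m f_j$. Let $\mathcal G$ be a connected graph on the nodes $\{1,\dots,m\}$ and let $W=(w_{il})\in\mathbb{R}^{m\times m}$ be a mixing matrix of $\mathcal G$: $w_{il}=0$ if $i\ne l$ and $\{i,l\}$ is not an edge, $w_{il}>0$ otherwise, $W=W^\top$, $\operatorname{null}(I-W)=\operatorname{span}\{\mathbf 1\}$, and $I\succeq W\succ -I$. Let $H$ be an irreducible, aperiodic $M\times M$ transition matrix whose stationary distribution is uniform on $\{1,\dots,M\}$. Each node $v$ runs a time-homogeneous Markov chain $(j_{v,k})_{k\ge0}$ on $\{1,\dots,M\}$ with transition matrix $H$ and arbitrary initial state, Markov with respect to the joint history of all nodes: $\mathbb{P}(j_{v,k+1}=t\mid (j_{u,i})_{u\le m,\,i\le k})=H_{j_{v,k},t}$ (for instance, the chains of different nodes are independent). Assume that every $f_j$ is bounded below, and that there are constants $B,L$ with $\|\nabla f_j^i(x)\|\le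 B$ and $\|\nabla f_j^i(x)-\nabla f_j^i(y)\|\le L\|x-y\|$ for all $i,j,x,y$. Let $\gamma_k=(k+1)^{-\theta}$ with $\frac12<\theta<1$. The decentralized Markov chain gradient descent (DMGD) iterates are given by $\mathbf{x}^0(v)=x^0$ for all $v$ and $$\mathbf{x}^{k+1}(v)=\sum_{l=1}^m w_{vl}\,\mathbf{x}^k(l)-\gamma_k\nabla f_v^{\,j_{v,k}}(\mathbf{x}^k(v)),\qquad 1\le v\le m,\ k\ge 0,$$ and $\overline{x^k}=\frac1m\sum_{v=1}^m\mathbf{x}^k(v)$. Then $$\lim_{k\to\infty}\mathbb{E}\|\nabla f(\overline{x^k})\|=0 .$$ Moreover, for a square matrix $A$ with simple dominant eigenvalue $1$ let $\rho(A)$ be the largest modulus of the remaining eigenvalues ($0$ if there are none), and put $\lambda(H)=\frac{\rho(H)+1}{2}$ and $\lambda_2(W)=\rho(W)$. Then $\lambda(H)\in[0,1)$ and, for every $k\ge1$, $$\min_{1\le i\le k}\mathbb{E}\|\nabla f(\overline{x^i})\|\le C\,\frac{\frac{1}{\ln(1/\lambda(H))}\cdot\frac{1}{1-\lambda_2(W)}}{k^{(1-\theta)/2}},$$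 where the constant $C$ depends only on $m$, $M$, $\theta$, $B$, $L$ and an upper bound $\Delta$ of $f(x^0)-\inf f$; in particular it does not depend on $\mathcal G$, $W$, $H$, the chains or $n$. -/

import Mathlib

open MeasureTheory Filter Topology

noncomputable section

namespace DMGD

/-- The parameter space `ℝⁿ` with its Euclidean norm. -/
abbrev Param (n : ℕ) : Type := EuclideanSpace ℝ (Fin n)

/-! ### The objective.  `f v s` is the `s`-th component function held by node `v`. -/

/-- The loss of node `v`: the average of its `M` component functions. -/
def localLoss {m M n : ℕ} (f : Fin m → Fin M → Param n → ℝ) (v : Fin m) (x : Param n) : ℝ :=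
  (1 / (M : ℝ)) * ∑ s, f v s x

/-- The global objective: the average of the losses of the `m` nodes. -/
def objective {m M n : ℕ} (f : Fin m → Fin M → Param n → ℝ) (x : Param n) : ℝ :=
  (1 / (m : ℝ)) * ∑ v, localLoss f v x

/-! ### The mixing matrix -/

/-- `W` is a mixing matrix for the graph `G`. -/
structure IsMixingMatrix {m : ℕ} (G : SimpleGraph (Fin m)) (W : Matrix (Fin m) (Fin m) ℝ) :
    Prop where
  zero_of_not_adj : ∀ i l, i ≠ l → ¬ G.Adj i l → W i l = 0
  pos_of_adj : ∀ i l, (i = l ∨ G.Adj i l) → 0 < W i l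
  symm : W.transpose = W
  null_space : LinearMap.ker (Matrix.toLin' (1 - W)) = Submodule.span ℝ {fun _ => (1 : ℝ)}
  le_one : (1 - W).PosSemidef
  neg_one_lt : (1 + W).PosDef

/-! ### The Markov chains -/

/-- `H` is a transition (row-stochastic) matrix. -/
def IsTransitionMatrix {M : ℕ} (H : Matrix (Fin M) (Fin M) ℝ) : Prop :=
  (∀ s t, 0 ≤ H s t) ∧ ∀ s, ∑ t, H s t = 1

/-- Every state can be reached from every state. -/
def IsIrreducible {M : ℕ} (H : Matrix (Fin M) (Fin M) ℝ) : Prop :=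
  ∀ s t, ∃ k : ℕ, 0 < (H ^ k) s t

/-- Every state has period one: `1` is the only common divisor of its return times. -/
def IsAperiodic {M : ℕ} (H : Matrix (Fin M) (Fin M) ℝ) : Prop :=
  ∀ s, ∀ d : ℕ, (∀ k : ℕ, 0 < (H ^ k) s s → d ∣ k) → d = 1

/-- The row vector `p` is stationary for `H`. -/
def IsStationary {M : ℕ} (H : Matrix (Fin M) (Fin M) ℝ) (p : Fin M → ℝ) : Prop :=
  Matrix.vecMul p H = p

/-- `j k v` is the state at time `k` of the chain run by node `v`.  Conditionally on the history
of all the nodes up to time `k`, the chain of each node moves according to `H`.  This says that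
each `j · v` is a time-homogeneous Markov chain with transition matrix `H`, with respect to the
joint history of the nodes; it holds in particular for independent chains with transition matrix
`H`.  Initial states are arbitrary. -/
structure IsMarkovSampling {m M : ℕ} {Ω : Type*} [MeasurableSpace Ω] (μ : Measure Ω)
    (H : Matrix (Fin M) (Fin M) ℝ) (j : ℕ → Fin m → Ω → Fin M) : Prop where
  measurable : ∀ k v, Measurable (j k v)
  markov : ∀ (k : ℕ) (a : ℕ → Fin m → Fin M) (v : Fin m) (t : Fin M),
    μ.real {ω | (∀ i ≤ k, ∀ u, j i u ω = a i u) ∧ j (k + 1) v ω = t} =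
      μ.real {ω | ∀ i ≤ k, ∀ u, j i u ω = a i u} * H (a k v) t

/-! ### Second eigenvalues -/

/-- The second largest modulus of the eigenvalues of a matrix that has the dominant eigenvalue
`1`: the largest modulus of its complex eigenvalues, listed with multiplicity, after one copy of
the eigenvalue `1` is removed (`0` for a one-by-one matrix). -/
def secondModulus {n : ℕ} (A : Matrix (Fin n) (Fin n) ℝ) : ℝ :=
  (((((A.map (algebraMap ℝ ℂ)).charpoly.roots.erase 1).map fun z => ‖z‖₊).sup : NNReal) : ℝ)

/-- `λ(H) = (max {|λ₂(H)|, |λ_min(H)|} + 1) / 2`. -/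
def mixingRate {M : ℕ} (H : Matrix (Fin M) (Fin M) ℝ) : ℝ :=
  (secondModulus H + 1) / 2

/-! ### The algorithm -/

/-- The stepsizes `γ_k = (k + 1)^(-θ)`. -/
def stepsize (θ : ℝ) (k : ℕ) : ℝ := 1 / ((k : ℝ) + 1) ^ θ

/-- The iterates along given sample trajectories: all nodes start from `x₀`, and at step `k` node
`v` averages with weights `W v ·` (which vanish outside the neighbours of `v` and `v` itself) and
takes a gradient step for its component `j k v`. -/
def iterate {m M n : ℕ} (W : Matrix (Fin m) (Fin m) ℝ) (γ : ℕ → ℝ)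
    (f : Fin m → Fin M → Param n → ℝ) (x₀ : Param n) (j : ℕ → Fin m → Fin M) :
    ℕ → Fin m → Param n
  | 0, _ => x₀
  | k + 1, v => (∑ l, W v l • iterate W γ f x₀ j k l) -
      γ k • gradient (f v (j k v)) (iterate W γ f x₀ j k v)

/-- The average of the local variables. -/
def nodeAverage {m n : ℕ} (x : Fin m → Param n) : Param n := (1 / (m : ℝ)) • ∑ v, x v

/-- The expected norm of the gradient of the objective at the node average of the `k`-th
iterate. -/
def expGradNorm {m M n : ℕ} {Ω : Type*} [MeasurableSpace Ω] (μ : Measure Ω)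
    (W : Matrix (Fin m) (Fin m) ℝ) (θ : ℝ) (f : Fin m → Fin M → Param n → ℝ) (x₀ : Param n)
    (j : ℕ → Fin m → Ω → Fin M) (k : ℕ) : ℝ :=
  ∫ ω, ‖gradient (objective f)
    (nodeAverage (iterate W (stepsize θ) f x₀ (fun i v => j i v ω) k))‖ ∂μ

end DMGD

end

noncomputable section

namespace DMGD

open scoped InnerProductSpace

/-- The averaging matrix, all entries of which are `1 / M`. -/
def averaging (M : ℕ) : Matrix (Fin M) (Fin M) ℝ := Matrix.of fun _ _ => 1 / (M : ℝ)

theorem mem_doublyStochastic_of_isStationary {M : ℕ} {H : Matrix (Fin M) (Fin M) ℝ}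
    (hH : IsTransitionMatrix H) (hs : IsStationary H (fun _ => 1 / (M : ℝ))) :
    H ∈ doublyStochastic ℝ (Fin M) := by
  rw [mem_doublyStochastic_iff_sum]
  refine ⟨hH.1, hH.2, fun t => ?_⟩
  have h := congrFun hs t
  have hM : (M : ℝ) ≠ 0 := by
    have : 0 < M := Fin.pos t
    positivity
  simp only [Matrix.vecMul, dotProduct, ← Finset.mul_sum] at h
  field_simp at h
  exact h

theorem exists_pow_pos {M : ℕ} {H : Matrix (Fin M) (Fin M) ℝ}
    (hH : IsTransitionMatrix H) (hirr : IsIrreducible H) (hap : IsAperiodic H) :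
    ∃ N : ℕ, 1 ≤ N ∧ ∀ s t, 0 < (H ^ N) s t := by
  have nonneg : ∀ k s t, 0 ≤ (H ^ k) s t := by
    intro k
    induction k with
    | zero => intro s t; rw [pow_zero, Matrix.one_apply]; split_ifs <;> norm_num
    | succ k ih =>
      intro s t
      rw [pow_succ, Matrix.mul_apply]
      exact Finset.sum_nonneg fun u _ => mul_nonneg (ih s u) (hH.1 u t)
  have trans : ∀ a b s t u, 0 < (H ^ a) s t → 0 < (H ^ b) t u → 0 < (H ^ (a + b)) s u := by
    intro a b s t u h1 h2
    rw [pow_add, Matrix.mul_apply]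
    exact lt_of_lt_of_le (mul_pos h1 h2)
      (Finset.single_le_sum (f := fun t => (H ^ a) s t * (H ^ b) t u)
        (fun v _ => mul_nonneg (nonneg a s v) (nonneg b v u)) (Finset.mem_univ t))
  have loops : ∀ s, ∃ K, ∀ k ≥ K, 0 < (H ^ k) s s := by
    intro s
    let S : AddSubmonoid ℕ :=
      { carrier := {k | 0 < (H ^ k) s s}
        zero_mem' := by simp
        add_mem' := fun {a b} ha hb => trans a b s s s ha hb }
    have hgcd : Nat.setGcd (S : Set ℕ) = 1 :=
      hap s _ fun k hk => Nat.setGcd_dvd_of_mem (s := (S : Set ℕ)) hk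
    obtain ⟨K, hK⟩ := Nat.exists_mem_closure_of_ge (S : Set ℕ)
    refine ⟨K, fun k hk => ?_⟩
    have := hK k hk (by simp [hgcd])
    rwa [AddSubmonoid.closure_eq] at this
  choose K hK using loops
  choose p hp using hirr
  refine ⟨1 + ∑ s, K s + ∑ s, ∑ t, p s t, by omega, fun s t => ?_⟩
  have h1 : K s ≤ ∑ s, K s := Finset.single_le_sum (fun _ _ => Nat.zero_le _) (Finset.mem_univ s)
  have h2 : p s t ≤ ∑ s, ∑ t, p s t :=
    (Finset.single_le_sum (f := p s) (fun _ _ => Nat.zero_le _) (Finset.mem_univ t)).trans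
      (Finset.single_le_sum (f := fun s => ∑ t, p s t) (fun _ _ => Nat.zero_le _)
        (Finset.mem_univ s))
  have h3 := trans (1 + ∑ s, K s + ∑ s, ∑ t, p s t - p s t) (p s t) s s t
    (hK s _ (by omega)) (hp s t)
  rwa [Nat.sub_add_cancel (by omega)] at h3

theorem mul_averaging {M : ℕ} {H : Matrix (Fin M) (Fin M) ℝ} (hH : H ∈ doublyStochastic ℝ (Fin M)) :
    H * averaging M = averaging M := by
  ext s t
  rw [mem_doublyStochastic_iff_sum] at hH
  simp [averaging, Matrix.mul_apply, ← Finset.sum_mul, hH.2.1 s]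

theorem averaging_mul {M : ℕ} {H : Matrix (Fin M) (Fin M) ℝ} (hH : H ∈ doublyStochastic ℝ (Fin M)) :
    averaging M * H = averaging M := by
  ext s t
  rw [mem_doublyStochastic_iff_sum] at hH
  simp [averaging, Matrix.mul_apply, ← Finset.mul_sum, hH.2.2 t]

theorem averaging_mem_doublyStochastic {M : ℕ} (hM : 0 < M) :
    averaging M ∈ doublyStochastic ℝ (Fin M) := by
  rw [mem_doublyStochastic_iff_sum]
  have : (M : ℝ) ≠ 0 := by positivity
  refine ⟨fun _ _ => by simp [averaging], fun _ => ?_, fun _ => ?_⟩ <;>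
    simp [averaging, this]

theorem sub_averaging_pow {M : ℕ} (hM : 0 < M) {H : Matrix (Fin M) (Fin M) ℝ}
    (hH : H ∈ doublyStochastic ℝ (Fin M)) (k : ℕ) :
    (H - averaging M) ^ (k + 1) = H ^ (k + 1) - averaging M := by
  induction k with
  | zero => simp
  | succ k ih =>
    rw [pow_succ, ih, pow_succ H (k + 1), sub_mul, mul_sub, mul_sub,
      mul_averaging (pow_mem hH _), averaging_mul hH, mul_averaging (averaging_mem_doublyStochastic hM)]
    abel

/-- The complexification of `H - averaging M`. -/
def deflation {M : ℕ} (H : Matrix (Fin M) (Fin M) ℝ) : Matrix (Fin M) (Fin M) ℂ :=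
  (H - averaging M).map (algebraMap ℝ ℂ)

open Polynomial in
theorem charpoly_mul_X {M : ℕ} (hM : 0 < M) {H : Matrix (Fin M) (Fin M) ℝ}
    (hH : H ∈ doublyStochastic ℝ (Fin M)) :
    (H.map (algebraMap ℝ ℂ)).charpoly * X = (X - C 1) * (deflation H).charpoly := by
  set P : Matrix (Fin M) (Fin M) ℂ := (averaging M).map (algebraMap ℝ ℂ) with hP
  set A : Matrix (Fin M) (Fin M) ℂ := H.map (algebraMap ℝ ℂ) with hA
  have hAP : A * P = P := by
    rw [hA, hP, ← Matrix.map_mul, mul_averaging hH]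
  have hd : deflation H = A - P := by
    ext i j; simp [deflation, hA, hP]
  have hP1 : (1 - P).charpoly = (X - C 1) ^ (M - 1) * X := by
    have h1 : 1 - P = Matrix.vecMulVec (fun _ => -(1 / M : ℂ)) (fun _ => 1) -
        Matrix.scalar (Fin M) (-1 : ℂ) := by
      ext i j
      simp [hP, averaging, Matrix.vecMulVec_apply, Matrix.one_apply, Matrix.diagonal_apply]
      split_ifs <;> simp
      ring
    have hM' : (M : ℂ) ≠ 0 := by exact_mod_cast hM.ne'
    rw [h1, Matrix.charpoly_sub_scalar, Matrix.charpoly_vecMulVec]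
    obtain ⟨d, rfl⟩ : ∃ d, M = d + 1 := ⟨M - 1, by omega⟩
    simp [dotProduct, ← sub_eq_add_neg, pow_succ]
    field_simp
    simp
    ring
  have key : Matrix.charmatrix A * Matrix.charmatrix (1 - P) =
      (X - C 1 : ℂ[X]) • Matrix.charmatrix (A - P) := by
    have e : ∀ B : Matrix (Fin M) (Fin M) ℂ, Matrix.charmatrix B =
      (X : ℂ[X]) • (1 : Matrix (Fin M) (Fin M) ℂ[X]) - (C : ℂ →+* ℂ[X]).mapMatrix B := by
      intro B
      rw [Matrix.charmatrix, Matrix.scalar_apply, Matrix.smul_one_eq_diagonal]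
    simp only [e, map_sub, map_one]
    have h2 : (C : ℂ →+* ℂ[X]).mapMatrix A * (C : ℂ →+* ℂ[X]).mapMatrix P =
        (C : ℂ →+* ℂ[X]).mapMatrix P := by rw [← map_mul, hAP]
    set a := (C : ℂ →+* ℂ[X]).mapMatrix A
    set p := (C : ℂ →+* ℂ[X]).mapMatrix P
    simp only [sub_mul, mul_sub, smul_mul_assoc, mul_smul_comm, one_mul, mul_one, h2, sub_smul,
      smul_sub, one_smul]
    abel
  have hdet := congrArg Matrix.det key
  rw [Matrix.det_mul, Matrix.det_smul, Fintype.card_fin] at hdet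
  change A.charpoly * (1 - P).charpoly = _ * (A - P).charpoly at hdet
  rw [hP1] at hdet
  rw [hd]
  have hne : (X - C 1 : ℂ[X]) ^ (M - 1) ≠ 0 := pow_ne_zero _ (X_sub_C_ne_zero 1)
  apply mul_left_cancel₀ hne
  calc _ = A.charpoly * ((X - C 1) ^ (M - 1) * X) := by ring
    _ = (X - C 1) ^ M * (A - P).charpoly := hdet
    _ = _ := by
      rw [← pow_sub_one_mul hM.ne' (X - C 1 : ℂ[X])]
      ring

open Polynomial in
theorem zero_cons_roots_erase_one {M : ℕ} (hM : 0 < M) {H : Matrix (Fin M) (Fin M) ℝ}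
    (hH : H ∈ doublyStochastic ℝ (Fin M)) :
    0 ::ₘ ((H.map (algebraMap ℝ ℂ)).charpoly.roots.erase 1) = (deflation H).charpoly.roots := by
  have h := congrArg Polynomial.roots (charpoly_mul_X hM hH)
  have n1 := (Matrix.charpoly_monic (H.map (algebraMap ℝ ℂ))).ne_zero
  have n2 := (Matrix.charpoly_monic (deflation H)).ne_zero
  rw [roots_mul (mul_ne_zero n1 X_ne_zero), roots_mul (mul_ne_zero (X_sub_C_ne_zero 1) n2),
    roots_X, roots_X_sub_C] at h
  have h1 : (1 : ℂ) ∈ (H.map (algebraMap ℝ ℂ)).charpoly.roots := by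
    have : (1 : ℂ) ∈ (H.map (algebraMap ℝ ℂ)).charpoly.roots + {0} := by rw [h]; simp
    simpa using this
  rw [← Multiset.cons_erase h1, Multiset.cons_add, Multiset.singleton_add] at h
  have := (Multiset.cons_inj_right _).1 h
  rw [← this, add_comm, Multiset.singleton_add]

theorem norm_le_secondModulus {M : ℕ} (hM : 0 < M) {H : Matrix (Fin M) (Fin M) ℝ}
    (hH : H ∈ doublyStochastic ℝ (Fin M)) {z : ℂ} (hz : z ∈ (deflation H).charpoly.roots) :
    ‖z‖ ≤ secondModulus H := by
  rw [← zero_cons_roots_erase_one hM hH, Multiset.mem_cons] at hz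
  rcases hz with rfl | hz
  · simp [secondModulus]
  · have := Multiset.le_sup (Multiset.mem_map_of_mem (fun z : ℂ => ‖z‖₊) hz)
    exact_mod_cast this

theorem secondModulus_lt_one_of_roots {M : ℕ} (hM : 0 < M) {H : Matrix (Fin M) (Fin M) ℝ}
    (hH : H ∈ doublyStochastic ℝ (Fin M))
    (h : ∀ z ∈ (deflation H).charpoly.roots, ‖z‖ < 1) : secondModulus H < 1 := by
  have sup_lt : ∀ s : Multiset NNReal, (∀ b ∈ s, b < 1) → s.sup < 1 := by
    intro s
    induction s using Multiset.induction with
    | empty => simp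
    | cons a s ih =>
      intro h
      rw [Multiset.sup_cons]
      exact max_lt (h a (Multiset.mem_cons_self a s))
        (ih fun b hb => h b (Multiset.mem_cons_of_mem hb))
  rw [secondModulus, ← NNReal.coe_one, NNReal.coe_lt_coe]
  refine sup_lt _ fun b hb => ?_
  obtain ⟨z, hz, rfl⟩ := Multiset.mem_map.1 hb
  have := h z (by rw [← zero_cons_roots_erase_one hM hH]; exact Multiset.mem_cons_of_mem hz)
  exact_mod_cast this

/-- Powers of a ring element that is annihilated by a product of linear factors with small roots
decay geometrically. -/
theorem norm_pow_mul_le {R : Type*} [NormedRing R] [NormOneClass R] [NormedAlgebra ℂ R] {a : R}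
    (ha : ‖a‖ ≤ 2) {ρ : ℝ} (hρ : 0 ≤ ρ) (hρ1 : ρ < 1) (l : List ℂ) (hl : ∀ z ∈ l, ‖z‖ ≤ ρ) :
    ∀ b : R, (l.map fun z => a - algebraMap ℂ R z).prod * b = 0 →
      ∀ k : ℕ, ‖a ^ k * b‖ ≤ (7 / (1 - ρ)) ^ l.length * ((1 + ρ) / 2) ^ k * ‖b‖ := by
  have hδ : 0 < 1 - ρ := by linarith
  have hK : (1 : ℝ) ≤ 7 / (1 - ρ) := by rw [le_div_iff₀ hδ]; linarith
  induction l using List.reverseRecOn with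
  | nil =>
    intro b hb k
    have : b = 0 := by simpa using hb
    simp [this]
  | append_singleton l z ih =>
    intro b hb k
    have hz : ‖z‖ ≤ ρ := hl z (by simp)
    have ih' := ih (fun w hw => hl w (by simp [hw])) ((a - algebraMap ℂ R z) * b)
      (by simpa [mul_assoc] using hb)
    set K := (7 / (1 - ρ)) ^ l.length with hKdef
    have hK1 : 1 ≤ K := one_le_pow₀ hK
    set r := (1 + ρ) / 2 with hr
    have hr0 : 0 < r := by rw [hr]; linarith
    have hc : ‖(a - algebraMap ℂ R z) * b‖ ≤ 3 * ‖b‖ := by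
      refine (norm_mul_le _ _).trans (mul_le_mul_of_nonneg_right ?_ (norm_nonneg _))
      refine (norm_sub_le _ _).trans ?_
      rw [norm_algebraMap']
      linarith
    suffices h : ‖a ^ k * b‖ ≤ (ρ ^ k + (3 * K / (r - ρ)) * (r ^ k - ρ ^ k)) * ‖b‖ by
      refine h.trans (mul_le_mul_of_nonneg_right ?_ (norm_nonneg _))
      have hrρ : r - ρ = (1 - ρ) / 2 := by rw [hr]; ring
      have h1 : 3 * K / (r - ρ) = 6 / (1 - ρ) * K := by rw [hrρ]; field_simp; norm_num
      have h2 : ρ ^ k ≤ r ^ k := pow_le_pow_left₀ hρ (by linarith) k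
      have h3 : (1 : ℝ) ≤ 1 / (1 - ρ) * K := by
        have : (1 : ℝ) ≤ 1 / (1 - ρ) := by rw [le_div_iff₀ hδ]; linarith
        nlinarith
      have h4 : 0 ≤ ρ ^ k := pow_nonneg hρ k
      rw [List.length_append, List.length_singleton, pow_succ, ← hKdef, h1]
      have e : K * (7 / (1 - ρ)) * r ^ k = 6 / (1 - ρ) * K * r ^ k + 1 / (1 - ρ) * K * r ^ k := by
        ring
      rw [e]
      have h5 : r ^ k ≤ 1 / (1 - ρ) * K * r ^ k := le_mul_of_one_le_left (by positivity) h3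
      have h6 : 0 ≤ 6 / (1 - ρ) * K * ρ ^ k := by positivity
      linarith
    induction k with
    | zero => simp
    | succ k ihk =>
      have e : a ^ (k + 1) * b = a ^ k * ((a - algebraMap ℂ R z) * b) + z • (a ^ k * b) := by
        rw [sub_mul, mul_sub, pow_succ, mul_assoc, ← mul_smul_comm, Algebra.smul_def]
        abel
      have hrρ : r - ρ ≠ 0 := by rw [hr]; intro h; linarith
      calc ‖a ^ (k + 1) * b‖ ≤ ‖a ^ k * ((a - algebraMap ℂ R z) * b)‖ + ‖z • (a ^ k * b)‖ := by
            rw [e]; exact norm_add_le _ _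
        _ ≤ K * r ^ k * (3 * ‖b‖) + ρ * ((ρ ^ k + (3 * K / (r - ρ)) * (r ^ k - ρ ^ k)) * ‖b‖) := by
            rw [norm_smul]
            gcongr
            exact (ih' k).trans (mul_le_mul_of_nonneg_left hc (by positivity))
        _ = _ := by
            field_simp
            ring

/-- A sequence bounded by `2` and by `(7 / δ) ^ d * (1 - δ / 2) ^ k` has its sum of order
`1 / δ ^ 2`. -/
theorem sum_le_of_le_geometric {a : ℕ → ℝ} {ρ : ℝ} (hρ : 0 ≤ ρ) (hρ1 : ρ < 1) (d : ℕ)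
    (h2 : ∀ k, a k ≤ 2) (hg : ∀ k, a k ≤ (7 / (1 - ρ)) ^ d * ((1 + ρ) / 2) ^ k) (N : ℕ) :
    ∑ k ∈ Finset.range N, a k ≤ (28 * d + 4) / (1 - ρ) ^ 2 := by
  set δ := 1 - ρ with hδdef
  have hδ : 0 < δ := by linarith
  have hδ1 : δ ≤ 1 := by linarith
  set T := ⌈14 * d / δ ^ 2⌉₊ with hT
  set r := (1 + ρ) / 2 with hr
  have hr0 : 0 < r := by linarith
  have hr1 : r < 1 := by linarith
  have hTr : (7 / δ) ^ d * r ^ T ≤ 1 := by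
    have h1 : (7 / δ) ^ d ≤ Real.exp (7 * d / δ) := by
      have : 7 / δ ≤ Real.exp (7 / δ) := by linarith [Real.add_one_le_exp (7 / δ)]
      calc (7 / δ) ^ d ≤ Real.exp (7 / δ) ^ d := pow_le_pow_left₀ (by positivity) this d
        _ = _ := by rw [← Real.exp_nat_mul]; congr 1; ring
    have h3 : r ^ T ≤ Real.exp (-(7 * d / δ)) := by
      have : r ≤ Real.exp (-(δ / 2)) := by
        have := Real.add_one_le_exp (-(δ / 2))
        have e : r = -(δ / 2) + 1 := by rw [hr, hδdef]; ring
        rwa [e]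
      calc r ^ T ≤ Real.exp (-(δ / 2)) ^ T := pow_le_pow_left₀ hr0.le this T
        _ = Real.exp (T * (-(δ / 2))) := by rw [← Real.exp_nat_mul]
        _ ≤ _ := by
          apply Real.exp_le_exp.2
          have := Nat.le_ceil (14 * d / δ ^ 2)
          have h4 : 14 * d / δ ^ 2 * (δ / 2) ≤ T * (δ / 2) := by gcongr
          have h5 : 14 * d / δ ^ 2 * (δ / 2) = 7 * d / δ := by field_simp; ring
          linarith
    calc _ ≤ Real.exp (7 * d / δ) * Real.exp (-(7 * d / δ)) := by gcongr
      _ = 1 := by rw [← Real.exp_add]; simp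
  have hgeo : ∀ n, ∑ k ∈ Finset.range n, r ^ k ≤ 2 / δ := by
    intro n
    rw [geom_sum_eq hr1.ne, ← neg_div_neg_eq, neg_sub, neg_sub]
    have e : 1 - r = δ / 2 := by rw [hr, hδdef]; ring
    rw [e, div_div_eq_mul_div]
    gcongr
    have : 0 ≤ r ^ n := by positivity
    linarith
  have hT2 : 2 * (T : ℝ) + 2 / δ ≤ (28 * d + 4) / δ ^ 2 := by
    have h1 : (T : ℝ) < 14 * d / δ ^ 2 + 1 := Nat.ceil_lt_add_one (by positivity)
    have h3 : 1 ≤ 1 / δ ^ 2 := by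
      rw [le_div_iff₀ (by positivity)]; nlinarith
    have h4 : 2 / δ ≤ 2 / δ ^ 2 := by
      gcongr
      nlinarith
    have e : (28 * d + 4) / δ ^ 2 = 2 * (14 * d / δ ^ 2) + 2 * (1 / δ ^ 2) + 2 / δ ^ 2 := by ring
    linarith
  refine le_trans ?_ hT2
  have hhead : ∀ n, ∑ k ∈ Finset.range n, a k ≤ 2 * n := by
    intro n
    calc _ ≤ ∑ k ∈ Finset.range n, (2 : ℝ) := Finset.sum_le_sum fun k _ => h2 k
      _ = _ := by simp; ring
  rcases le_total N T with hNT | hNT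
  · have : (N : ℝ) ≤ T := by exact_mod_cast hNT
    have : 0 < 2 / δ := by positivity
    linarith [hhead N]
  · obtain ⟨n, rfl⟩ := Nat.exists_eq_add_of_le hNT
    rw [Finset.sum_range_add]
    have : ∑ k ∈ Finset.range n, a (T + k) ≤ ∑ k ∈ Finset.range n, r ^ k := by
      refine Finset.sum_le_sum fun k _ => ?_
      calc a (T + k) ≤ (7 / δ) ^ d * r ^ (T + k) := hg _
        _ = ((7 / δ) ^ d * r ^ T) * r ^ k := by rw [mul_assoc, ← pow_add]
        _ ≤ 1 * r ^ k := by gcongr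
        _ = _ := by ring
    linarith [hhead T, hgeo n]

section

attribute [local instance] Matrix.linftyOpNormedRing Matrix.linftyOpNormedAlgebra

theorem linfty_opNorm_le {M : ℕ} {𝕜 : Type*} [NormedRing 𝕜] (A : Matrix (Fin M) (Fin M) 𝕜) {c : ℝ}
    (hc : 0 ≤ c) (h : ∀ s, ∑ t, ‖A s t‖ ≤ c) : ‖A‖ ≤ c := by
  lift c to NNReal using hc
  rw [Matrix.linfty_opNorm_def, NNReal.coe_le_coe]
  refine Finset.sup_le fun s _ => ?_
  rw [← NNReal.coe_le_coe]
  simpa using h s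

theorem sum_norm_le_linfty_opNorm {M : ℕ} {𝕜 : Type*} [NormedRing 𝕜]
    (A : Matrix (Fin M) (Fin M) 𝕜) (s : Fin M) : ∑ t, ‖A s t‖ ≤ ‖A‖ := by
  rw [Matrix.linfty_opNorm_def]
  have := Finset.le_sup (f := fun i => ∑ j, ‖A i j‖₊) (Finset.mem_univ s)
  rw [← NNReal.coe_le_coe] at this
  simpa using this

theorem norm_lt_one_of_mem_roots {M : ℕ} (hM : 0 < M) {H : Matrix (Fin M) (Fin M) ℝ}
    (hH : H ∈ doublyStochastic ℝ (Fin M)) {N : ℕ} (hN : 1 ≤ N) (hpos : ∀ s t, 0 < (H ^ N) s t)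
    {z : ℂ} (hz : z ∈ (deflation H).charpoly.roots) : ‖z‖ < 1 := by
  have : Nonempty (Fin M) := ⟨⟨0, hM⟩⟩
  by_cases hz0 : z = 0
  · simp [hz0]
  have hroot := (Polynomial.mem_roots'.1 hz).2
  rw [Polynomial.IsRoot, Matrix.eval_charpoly] at hroot
  obtain ⟨v, hv, hzv⟩ := Matrix.exists_mulVec_eq_zero_iff.2 hroot
  have hev : (deflation H).mulVec v = z • v := by
    rw [Matrix.sub_mulVec, sub_eq_zero] at hzv
    rw [← hzv]
    ext i
    simp [Matrix.scalar_apply, Matrix.mulVec_diagonal]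
  set P : Matrix (Fin M) (Fin M) ℂ := (averaging M).map (algebraMap ℝ ℂ) with hP
  have hPd : P * deflation H = 0 := by
    rw [hP, deflation, ← Matrix.map_mul, mul_sub, averaging_mul hH,
      averaging_mul (averaging_mem_doublyStochastic hM), sub_self]
    simp
  have hPv : P.mulVec v = 0 := by
    have h1 : (P * deflation H).mulVec v = z • P.mulVec v := by
      rw [← Matrix.mulVec_mulVec, hev, Matrix.mulVec_smul]
    rw [hPd, Matrix.zero_mulVec] at h1
    exact (smul_eq_zero.1 h1.symm).resolve_left hz0
  have hpow : ∀ k : ℕ, ((deflation H) ^ k).mulVec v = z ^ k • v := by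
    intro k
    induction k with
    | zero => simp
    | succ k ih =>
      rw [pow_succ, ← Matrix.mulVec_mulVec, hev, Matrix.mulVec_smul, ih, smul_smul, pow_succ']
  obtain ⟨p, -, hp⟩ := Finset.exists_min_image (Finset.univ : Finset (Fin M × Fin M))
    (fun p => (H ^ N) p.1 p.2) ⟨Classical.arbitrary _, Finset.mem_univ _⟩
  set ε := (H ^ N) p.1 p.2 with hε
  have hε0 : 0 < ε := hpos _ _
  have hHN := pow_mem hH N
  have hMε : M * ε ≤ 1 := by
    rw [← sum_row_of_mem_doublyStochastic hHN p.1]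
    calc M * ε = ∑ t : Fin M, ε := by simp
      _ ≤ _ := Finset.sum_le_sum fun t _ => hp (p.1, t) (Finset.mem_univ _)
  set Q : Matrix (Fin M) (Fin M) ℂ :=
    (Matrix.of fun s t => (H ^ N) s t - ε).map (algebraMap ℝ ℂ) with hQ
  have hQn : ‖Q‖ ≤ 1 - M * ε := by
    refine linfty_opNorm_le Q (by linarith) fun s => le_of_eq ?_
    calc ∑ t, ‖Q s t‖ = ∑ t, ((H ^ N) s t - ε) := by
          refine Finset.sum_congr rfl fun t _ => ?_
          have := hp (s, t) (Finset.mem_univ _)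
          simp only [hQ, Matrix.map_apply, Matrix.of_apply, Complex.coe_algebraMap,
            Complex.norm_real]
          exact abs_of_nonneg (sub_nonneg.2 this)
      _ = _ := by
          rw [Finset.sum_sub_distrib, sum_row_of_mem_doublyStochastic hHN]
          simp
  have hQe : Q = (deflation H) ^ N + ((1 - M * ε : ℝ) : ℂ) • P := by
    obtain ⟨k, rfl⟩ := Nat.exists_eq_add_of_le' hN
    have hM' : (M : ℂ) ≠ 0 := by exact_mod_cast hM.ne'
    rw [deflation, ← Matrix.map_pow, sub_averaging_pow hM hH]
    ext s t
    simp [hQ, hP, averaging]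
    field_simp
    ring
  have hQv : Q.mulVec v = z ^ N • v := by
    rw [hQe, Matrix.add_mulVec, Matrix.smul_mulVec, hPv, hpow]
    simp
  have hle := Matrix.linfty_opNorm_mulVec Q v
  rw [hQv, norm_smul, norm_pow] at hle
  have hvn : 0 < ‖v‖ := norm_pos_iff.2 hv
  have hlt : ‖z‖ ^ N < 1 := by
    have h1 : ‖z‖ ^ N * ‖v‖ ≤ (1 - M * ε) * ‖v‖ :=
      hle.trans (mul_le_mul_of_nonneg_right hQn hvn.le)
    have h2 := le_of_mul_le_mul_right h1 hvn
    have h3 : 0 < M * ε := by positivity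
    linarith
  exact lt_of_not_ge fun h => absurd (one_le_pow₀ h) (not_le.2 hlt)

theorem linfty_opNorm_deflation_pow_le {M : ℕ} (hM : 0 < M) {H : Matrix (Fin M) (Fin M) ℝ}
    (hH : H ∈ doublyStochastic ℝ (Fin M)) (k : ℕ) : ‖(deflation H) ^ k‖ ≤ 2 := by
  have : Nonempty (Fin M) := ⟨⟨0, hM⟩⟩
  have hdst : ∀ A ∈ doublyStochastic ℝ (Fin M), ‖A.map (algebraMap ℝ ℂ)‖ ≤ 1 := by
    intro A hA
    refine linfty_opNorm_le _ zero_le_one fun s => le_of_eq ?_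
    rw [← sum_row_of_mem_doublyStochastic hA s]
    refine Finset.sum_congr rfl fun t _ => ?_
    simp [abs_of_nonneg (nonneg_of_mem_doublyStochastic hA)]
  cases k with
  | zero => simp
  | succ k =>
    have e : (deflation H) ^ (k + 1) =
        (H ^ (k + 1)).map (algebraMap ℝ ℂ) - (averaging M).map (algebraMap ℝ ℂ) := by
      rw [deflation, ← Matrix.map_pow, sub_averaging_pow hM hH]
      ext s t
      simp
    rw [e]
    refine (norm_sub_le _ _).trans ?_
    linarith [hdst _ (pow_mem hH (k + 1)), hdst _ (averaging_mem_doublyStochastic hM)]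

theorem linfty_opNorm_deflation_pow_le_geometric {M : ℕ} (hM : 0 < M)
    {H : Matrix (Fin M) (Fin M) ℝ} (hH : H ∈ doublyStochastic ℝ (Fin M))
    (hρ : secondModulus H < 1) (k : ℕ) :
    ‖(deflation H) ^ k‖ ≤ (7 / (1 - secondModulus H)) ^ M * ((1 + secondModulus H) / 2) ^ k := by
  have : Nonempty (Fin M) := ⟨⟨0, hM⟩⟩
  have hsplit : (deflation H).charpoly.Splits := IsAlgClosed.splits _
  have hlen : (deflation H).charpoly.roots.toList.length = M := by
    rw [Multiset.length_toList, ← hsplit.natDegree_eq_card_roots, Matrix.charpoly_natDegree_eq_dim,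
      Fintype.card_fin]
  have hCH : ((deflation H).charpoly.roots.toList.map
      fun z => deflation H - algebraMap ℂ _ z).prod = 0 := by
    have h := Matrix.aeval_self_charpoly (deflation H)
    rw [hsplit.eq_prod_roots_of_monic (Matrix.charpoly_monic _)] at h
    rw [← h, ← Multiset.coe_toList (deflation H).charpoly.roots, Multiset.map_coe,
      Multiset.prod_coe, map_list_prod, List.map_map]
    simp [Function.comp_def]
  have h1 : ‖deflation H‖ ≤ 2 := by simpa using linfty_opNorm_deflation_pow_le hM hH 1
  have := norm_pow_mul_le h1 (NNReal.coe_nonneg _) hρ (deflation H).charpoly.roots.toList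
    (fun z hz => norm_le_secondModulus hM hH (Multiset.mem_toList.1 hz)) 1 (by rw [hCH, zero_mul]) k
  rwa [hlen, mul_one, norm_one, mul_one] at this

end

section

attribute [local instance] Matrix.linftyOpNormedRing Matrix.linftyOpNormedAlgebra

theorem sum_row_abs_le_linfty_opNorm {M : ℕ} (hM : 0 < M) {H : Matrix (Fin M) (Fin M) ℝ}
    (hH : H ∈ doublyStochastic ℝ (Fin M)) (k : ℕ) (s : Fin M) :
    ∑ t, |(H ^ (k + 1) - averaging M) s t| ≤ ‖(deflation H) ^ (k + 1)‖ := by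
  refine le_trans (le_of_eq ?_) (sum_norm_le_linfty_opNorm _ s)
  rw [deflation, ← Matrix.map_pow, sub_averaging_pow hM hH]
  simp only [Matrix.map_apply, Complex.coe_algebraMap, Complex.norm_real, Real.norm_eq_abs]

/-- The distances of the powers of a doubly stochastic matrix from the averaging matrix have a sum
that is controlled by the second eigenvalue. -/
theorem sum_sum_row_abs_le {M : ℕ} (hM : 0 < M) {H : Matrix (Fin M) (Fin M) ℝ}
    (hH : H ∈ doublyStochastic ℝ (Fin M)) (hρ : secondModulus H < 1) (N : ℕ) (s : Fin M) :
    ∑ k ∈ Finset.range N, ∑ t, |(H ^ k - averaging M) s t| ≤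
      (28 * M + 4) / (1 - secondModulus H) ^ 2 := by
  have hρ0 : 0 ≤ secondModulus H := NNReal.coe_nonneg _
  have hzero : ∑ t, |(H ^ 0 - averaging M) s t| ≤ 2 := by
    calc _ ≤ ∑ t, ((1 : Matrix (Fin M) (Fin M) ℝ) s t + averaging M s t) := by
          refine Finset.sum_le_sum fun t _ => ?_
          rw [pow_zero, Matrix.sub_apply]
          refine (abs_sub _ _).trans (le_of_eq ?_)
          rw [abs_of_nonneg, abs_of_nonneg]
          · exact nonneg_of_mem_doublyStochastic (averaging_mem_doublyStochastic hM)
          · exact nonneg_of_mem_doublyStochastic (one_mem _)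
      _ = 2 := by
          rw [Finset.sum_add_distrib, sum_row_of_mem_doublyStochastic (one_mem _),
            sum_row_of_mem_doublyStochastic (averaging_mem_doublyStochastic hM)]
          norm_num
  refine sum_le_of_le_geometric hρ0 hρ M (fun k => ?_) (fun k => ?_) N
  · cases k with
    | zero => exact hzero
    | succ k =>
      exact (sum_row_abs_le_linfty_opNorm hM hH k s).trans (linfty_opNorm_deflation_pow_le hM hH _)
  · cases k with
    | zero =>
      have h7 : (7 : ℝ) ≤ 7 / (1 - secondModulus H) := by
        rw [le_div_iff₀ (by linarith)]; linarith
      have : (7 : ℝ) ≤ (7 / (1 - secondModulus H)) ^ M :=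
        h7.trans (le_self_pow₀ (by linarith) hM.ne')
      rw [pow_zero ((1 + secondModulus H) / 2), mul_one]
      exact hzero.trans (by linarith)
    | succ k =>
      exact (sum_row_abs_le_linfty_opNorm hM hH k s).trans
        (linfty_opNorm_deflation_pow_le_geometric hM hH hρ _)

end

theorem secondModulus_lt_one {M : ℕ} (hM : 0 < M) {H : Matrix (Fin M) (Fin M) ℝ}
    (hH : IsTransitionMatrix H) (hirr : IsIrreducible H) (hap : IsAperiodic H)
    (hs : IsStationary H (fun _ => 1 / (M : ℝ))) : secondModulus H < 1 := by
  obtain ⟨N, hN, hpos⟩ := exists_pow_pos hH hirr hap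
  have hd := mem_doublyStochastic_of_isStationary hH hs
  exact secondModulus_lt_one_of_roots hM hd fun z hz => norm_lt_one_of_mem_roots hM hd hN hpos hz

/-- The Poisson equation of the chain with transition matrix `H` has a solution that is controlled
by the second eigenvalue. -/
theorem exists_poisson_solution {M : ℕ} (hM : 0 < M) {H : Matrix (Fin M) (Fin M) ℝ}
    (hH : H ∈ doublyStochastic ℝ (Fin M)) (hρ : secondModulus H < 1) :
    ∃ G : Matrix (Fin M) (Fin M) ℝ, G - H * G = 1 - averaging M ∧
      ∀ s, ∑ t, |G s t| ≤ (28 * M + 4) / (1 - secondModulus H) ^ 2 := by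
  have hbd := sum_sum_row_abs_le hM hH hρ
  have hsum : Summable fun k => H ^ k - averaging M := by
    refine Pi.summable.2 fun s => Pi.summable.2 fun t => ?_
    refine Summable.of_abs (summable_of_sum_range_le
      (c := (28 * M + 4) / (1 - secondModulus H) ^ 2) (fun k => abs_nonneg _) fun N => ?_)
    refine le_trans (Finset.sum_le_sum fun k _ => ?_) (hbd N s)
    exact Finset.single_le_sum (f := fun t => |(H ^ k - averaging M) s t|)
      (fun _ _ => abs_nonneg _) (Finset.mem_univ t)
  refine ⟨∑' k, (H ^ k - averaging M), ?_, fun s => ?_⟩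
  · rw [← hsum.tsum_mul_left, sub_eq_iff_eq_add, hsum.tsum_eq_zero_add, pow_zero]
    congr 1
    refine tsum_congr fun k => ?_
    rw [mul_sub, mul_averaging hH, pow_succ']
  · have ht : Tendsto (fun N => ∑ t, |(∑ k ∈ Finset.range N, (H ^ k - averaging M)) s t|) atTop
        (𝓝 (∑ t, |(∑' k, (H ^ k - averaging M)) s t|)) := by
      refine tendsto_finsetSum _ fun t _ => ?_
      exact ((tendsto_pi_nhds.1 (tendsto_pi_nhds.1 hsum.hasSum.tendsto_sum_nat s)) t).abs
    refine le_of_tendsto' ht fun N => le_trans ?_ (hbd N s)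
    rw [Finset.sum_comm]
    refine Finset.sum_le_sum fun t _ => ?_
    rw [Matrix.sum_apply]
    exact Finset.abs_sum_le_sum_abs _ _

theorem isTransitionMatrix_of_isMixingMatrix {m : ℕ} {G : SimpleGraph (Fin m)}
    {W : Matrix (Fin m) (Fin m) ℝ} (hW : IsMixingMatrix G W) : IsTransitionMatrix W := by
  refine ⟨fun s t => ?_, fun s => ?_⟩
  · by_cases h : s = t ∨ G.Adj s t
    · exact (hW.pos_of_adj s t h).le
    · push Not at h
      exact (hW.zero_of_not_adj s t h.1 h.2).ge
  · have h1 : (fun _ => (1 : ℝ)) ∈ LinearMap.ker (Matrix.toLin' (1 - W)) := by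
      rw [hW.null_space]
      exact Submodule.mem_span_singleton_self _
    rw [LinearMap.mem_ker, Matrix.toLin'_apply, Matrix.sub_mulVec, Matrix.one_mulVec] at h1
    have := congrFun h1 s
    simp only [Matrix.mulVec, dotProduct, Pi.sub_apply, Pi.zero_apply, mul_one] at this
    linarith

theorem isStationary_of_isMixingMatrix {m : ℕ} {G : SimpleGraph (Fin m)}
    {W : Matrix (Fin m) (Fin m) ℝ} (hW : IsMixingMatrix G W) :
    IsStationary W (fun _ => 1 / (m : ℝ)) := by
  ext t
  have h := (isTransitionMatrix_of_isMixingMatrix hW).2 t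
  simp only [Matrix.vecMul, dotProduct, ← Finset.mul_sum]
  rw [← hW.symm]
  simp [h]

theorem isAperiodic_of_isMixingMatrix {m : ℕ} {G : SimpleGraph (Fin m)}
    {W : Matrix (Fin m) (Fin m) ℝ} (hW : IsMixingMatrix G W) : IsAperiodic W := by
  intro s d h
  exact Nat.dvd_one.1 (h 1 (by simpa using hW.pos_of_adj s s (Or.inl rfl)))

theorem isIrreducible_of_isMixingMatrix {m : ℕ} {G : SimpleGraph (Fin m)} (hG : G.Connected)
    {W : Matrix (Fin m) (Fin m) ℝ} (hW : IsMixingMatrix G W) : IsIrreducible W := by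
  have nonneg : ∀ k s t, 0 ≤ (W ^ k) s t := by
    have hd := mem_doublyStochastic_of_isStationary (isTransitionMatrix_of_isMixingMatrix hW)
      (isStationary_of_isMixingMatrix hW)
    exact fun k s t => nonneg_of_mem_doublyStochastic (pow_mem hd k)
  intro s t
  obtain ⟨p⟩ := hG.preconnected s t
  induction p with
  | nil => exact ⟨0, by simp⟩
  | @cons u v w h p ih =>
    obtain ⟨k, hk⟩ := ih
    refine ⟨k + 1, ?_⟩
    rw [pow_succ', Matrix.mul_apply]
    exact lt_of_lt_of_le (mul_pos (hW.pos_of_adj u v (Or.inr h)) hk)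
      (Finset.single_le_sum (f := fun t => W u t * (W ^ k) t w)
        (fun x _ => mul_nonneg ((isTransitionMatrix_of_isMixingMatrix hW).1 u x) (nonneg k x w))
        (Finset.mem_univ v))

theorem log_one_div_mixingRate_le {M : ℕ} {H : Matrix (Fin M) (Fin M) ℝ}
    (hρ : secondModulus H < 1) : Real.log (1 / mixingRate H) ≤ 1 - secondModulus H := by
  have h0 : 0 ≤ secondModulus H := NNReal.coe_nonneg _
  have hpos : 0 < mixingRate H := by rw [mixingRate]; linarith
  refine (Real.log_le_sub_one_of_pos (by positivity)).trans ?_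
  rw [div_sub_one hpos.ne', div_le_iff₀ hpos, mixingRate]
  nlinarith

theorem norm_average_le {E : Type*} [NormedAddCommGroup E] [NormedSpace ℝ E] {m : ℕ} (hm : 0 < m)
    {u : Fin m → E} {c : ℝ} (h : ∀ v, ‖u v‖ ≤ c) : ‖(1 / (m : ℝ)) • ∑ v, u v‖ ≤ c := by
  have hm' : (0 : ℝ) < m := by exact_mod_cast hm
  rw [norm_smul, Real.norm_of_nonneg (by positivity), one_div, inv_mul_le_iff₀ hm']
  calc _ ≤ ∑ v, ‖u v‖ := norm_sum_le _ _
    _ ≤ ∑ v : Fin m, c := Finset.sum_le_sum fun v _ => h v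
    _ = _ := by simp

theorem hasGradientAt_average {E : Type*} [NormedAddCommGroup E] [InnerProductSpace ℝ E]
    [CompleteSpace E] {ι : Type*} [Fintype ι] (c : ℝ) {f : ι → E → ℝ} {f' : ι → E} {x : E}
    (h : ∀ i, HasGradientAt (f i) (f' i) x) :
    HasGradientAt (fun y => c * ∑ i, f i y) (c • ∑ i, f' i) x := by
  rw [hasGradientAt_iff_hasFDerivAt]
  have h1 := (HasFDerivAt.fun_sum fun i (_ : i ∈ Finset.univ) =>
    (hasGradientAt_iff_hasFDerivAt.1 (h i))).const_mul c
  rw [map_smul, map_sum]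
  exact h1

/-- The descent inequality for a function with Lipschitz gradient. -/
theorem le_add_inner_gradient {E : Type*} [NormedAddCommGroup E] [InnerProductSpace ℝ E]
    [CompleteSpace E] {F : E → ℝ} (hF : Differentiable ℝ F) {L : ℝ} (hL : 0 ≤ L)
    (hlip : ∀ x y, ‖gradient F x - gradient F y‖ ≤ L * ‖x - y‖) (x y : E) :
    F y ≤ F x + ⟪gradient F x, y - x⟫_ℝ + L * ‖y - x‖ ^ 2 := by
  have h := Convex.norm_image_sub_le_of_norm_hasFDerivWithin_le' (𝕜 := ℝ) (f := F)
    (f' := fun z => fderiv ℝ F z) (φ := fderiv ℝ F x) (s := segment ℝ x y) (C := L * ‖y - x‖)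
    (fun z _ => (hF z).hasFDerivAt.hasFDerivWithinAt) (fun z hz => ?_) (convex_segment x y)
    (left_mem_segment ℝ x y) (right_mem_segment ℝ x y)
  · rw [← inner_gradient_left] at h
    have := (le_abs_self _).trans h
    nlinarith
  · rw [← toDual_gradient, ← toDual_gradient, ← map_sub, LinearIsometryEquiv.norm_map]
    refine (hlip z x).trans (mul_le_mul_of_nonneg_left ?_ hL)
    obtain ⟨a, b, ha, hb, hab, rfl⟩ := hz
    have e : a • x + b • y - x = b • (y - x) := by
      have : a = 1 - b := by linarith
      rw [this]; module
    rw [e, norm_smul, Real.norm_of_nonneg hb]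
    exact mul_le_of_le_one_left (norm_nonneg _) (by linarith)

theorem sum_sum_range_eq (g a : ℕ → ℝ) (N : ℕ) :
    ∑ k ∈ Finset.range N, ∑ i ∈ Finset.range k, g i * a (k - 1 - i) =
      ∑ i ∈ Finset.range N, g i * ∑ r ∈ Finset.range (N - 1 - i), a r := by
  induction N with
  | zero => simp
  | succ N ih =>
    rw [Finset.sum_range_succ, ih, Finset.sum_range_succ _ N, ← Finset.sum_add_distrib]
    have : N + 1 - 1 - N = 0 := by omega
    rw [this, Finset.sum_range_zero, mul_zero, add_zero]
    refine Finset.sum_congr rfl fun i hi => ?_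
    have hi' := Finset.mem_range.1 hi
    rw [show N + 1 - 1 - i = (N - 1 - i) + 1 by omega, Finset.sum_range_succ]
    ring

theorem sum_convolution_le {γ a : ℕ → ℝ} (hγ : Antitone γ) (hγ0 : ∀ k, 0 ≤ γ k)
    (ha : ∀ r, 0 ≤ a r) {K : ℝ} (hK : ∀ N, ∑ r ∈ Finset.range N, a r ≤ K) (N : ℕ) :
    ∑ k ∈ Finset.range N, γ k * ∑ i ∈ Finset.range k, γ i * a (k - 1 - i) ≤
      K * ∑ i ∈ Finset.range N, γ i ^ 2 := by
  calc _ ≤ ∑ k ∈ Finset.range N, ∑ i ∈ Finset.range k, γ i ^ 2 * a (k - 1 - i) := by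
        refine Finset.sum_le_sum fun k _ => ?_
        rw [Finset.mul_sum]
        refine Finset.sum_le_sum fun i hi => ?_
        rw [sq, ← mul_assoc]
        exact mul_le_mul_of_nonneg_right (mul_le_mul_of_nonneg_right
          (hγ (Finset.mem_range.1 hi).le) (hγ0 i)) (ha _)
    _ = _ := sum_sum_range_eq (fun i => γ i ^ 2) a N
    _ ≤ ∑ i ∈ Finset.range N, γ i ^ 2 * K :=
        Finset.sum_le_sum fun i _ => mul_le_mul_of_nonneg_left (hK _) (sq_nonneg _)
    _ = _ := by rw [← Finset.sum_mul, mul_comm]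

theorem sum_mul_sub_le {γ Φ : ℕ → ℝ} (hγ : Antitone γ) (hγ0 : ∀ k, 0 ≤ γ k) {c : ℝ}
    (hΦ : ∀ k, |Φ k| ≤ c) (N : ℕ) :
    ∑ k ∈ Finset.range N, γ k * (Φ (k + 1) - Φ k) ≤ 2 * c * γ 0 := by
  have h : ∀ N, ∑ k ∈ Finset.range N, γ k * (Φ (k + 1) - Φ k) ≤
      γ N * Φ N - γ 0 * Φ 0 + c * (γ 0 - γ N) := by
    intro N
    induction N with
    | zero => simp
    | succ N ih =>
      rw [Finset.sum_range_succ]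
      have h1 := hγ (Nat.le_succ N)
      have h2 := (le_abs_self _).trans (hΦ (N + 1))
      have h3 := mul_le_mul_of_nonneg_left h2 (sub_nonneg.2 h1)
      simp only [Nat.succ_eq_add_one] at h3
      linarith
  have h1 := mul_le_mul_of_nonneg_left ((le_abs_self _).trans (hΦ N)) (hγ0 N)
  have h2 := mul_le_mul_of_nonneg_left ((neg_le_abs _).trans (hΦ 0)) (hγ0 0)
  linarith [h N]

/-- A nonnegative sequence that varies slowly and whose squares have a finite weighted sum tends
to zero. -/
theorem tendsto_zero_of_sum_mul_sq {γ u : ℕ → ℝ} (hγ0 : ∀ k, 0 ≤ γ k)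
    (hγ : ¬ Summable γ) (hγ3 : Summable fun k => γ k ^ 3) (hu : ∀ k, 0 ≤ u k) {c : ℝ}
    (hc : ∀ k, |u (k + 1) - u k| ≤ c * γ k) (hs : Summable fun k => γ k * u k ^ 2) :
    Tendsto u atTop (𝓝 0) := by
  have hdiff : Summable fun k => dist (u k ^ 3) (u (k + 1) ^ 3) := by
    have hbd : Summable fun k => |c| * (5 * (γ k * u k ^ 2) + 3 * c ^ 2 * γ k ^ 3) :=
      ((hs.mul_left 5).add (hγ3.mul_left (3 * c ^ 2))).mul_left |c|
    refine Summable.of_nonneg_of_le (fun _ => dist_nonneg) (fun k => ?_) hbd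
    have h1 := hc k
    have h2 : u (k + 1) ^ 2 ≤ 2 * u k ^ 2 + 2 * c ^ 2 * γ k ^ 2 := by
      have h3 : (u (k + 1) - u k) ^ 2 ≤ (c * γ k) ^ 2 := sq_le_sq' (by
        linarith [neg_le_abs (u (k + 1) - u k)]) ((le_abs_self _).trans h1)
      nlinarith [sq_nonneg (u (k + 1) - 2 * u k)]
    rw [dist_comm, Real.dist_eq]
    have e : u (k + 1) ^ 3 - u k ^ 3 =
        (u (k + 1) - u k) * (u (k + 1) ^ 2 + u (k + 1) * u k + u k ^ 2) := by ring
    have hq : 0 ≤ u (k + 1) ^ 2 + u (k + 1) * u k + u k ^ 2 := by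
      have := hu k; have := hu (k + 1); positivity
    rw [e, abs_mul, abs_of_nonneg hq]
    have h4 : u (k + 1) ^ 2 + u (k + 1) * u k + u k ^ 2 ≤ 5 * u k ^ 2 + 3 * c ^ 2 * γ k ^ 2 := by
      nlinarith [sq_nonneg (u (k + 1) - u k)]
    have h5 : |u (k + 1) - u k| ≤ |c| * γ k :=
      h1.trans (mul_le_mul_of_nonneg_right (le_abs_self c) (hγ0 k))
    calc _ ≤ (|c| * γ k) * (5 * u k ^ 2 + 3 * c ^ 2 * γ k ^ 2) :=
          mul_le_mul h5 h4 hq ((abs_nonneg _).trans h5)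
      _ = _ := by ring
  obtain ⟨l, hl⟩ := cauchySeq_tendsto_of_complete (cauchySeq_of_summable_dist hdiff)
  have hl0 : 0 ≤ l := ge_of_tendsto' hl fun k => pow_nonneg (hu k) 3
  have hroot : Tendsto u atTop (𝓝 (l ^ ((1 : ℝ) / 3))) := by
    have := hl.rpow_const (p := (1 : ℝ) / 3) (Or.inr (by norm_num))
    refine this.congr fun k => ?_
    rw [← Real.rpow_natCast, ← Real.rpow_mul (hu k)]
    norm_num
  set r := l ^ ((1 : ℝ) / 3) with hr
  have hr0 : 0 ≤ r := Real.rpow_nonneg hl0 _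
  rcases hr0.eq_or_lt with h0 | h0
  · rwa [← h0] at hroot
  · exfalso
    apply hγ
    have hev := (hroot.pow 2).eventually (lt_mem_nhds (show r ^ 2 / 2 < r ^ 2 by
      have : 0 < r ^ 2 := by positivity
      linarith))
    obtain ⟨N, hN⟩ := eventually_atTop.1 hev
    have hs' := (hs.mul_left (2 / r ^ 2))
    rw [← summable_nat_add_iff N] at hs' ⊢
    refine Summable.of_nonneg_of_le (fun k => hγ0 _) (fun k => ?_) hs'
    have h1 := (hN (k + N) (by omega)).le
    have h2 := mul_le_mul_of_nonneg_left h1 (hγ0 (k + N))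
    rw [div_mul_eq_mul_div, le_div_iff₀ (by positivity)]
    linarith

/-- The component functions are differentiable with bounded Lipschitz gradients. -/
structure IsRegular {m M n : ℕ} (f : Fin m → Fin M → Param n → ℝ) (B L : ℝ) : Prop where
  diff : ∀ v s, Differentiable ℝ (f v s)
  bound : ∀ v s x, ‖gradient (f v s) x‖ ≤ B
  lip : ∀ v s x y, ‖gradient (f v s) x - gradient (f v s) y‖ ≤ L * ‖x - y‖
  bound_nonneg : 0 ≤ B
  lip_nonneg : 0 ≤ L

section Objective

variable {m M n : ℕ} {f : Fin m → Fin M → Param n → ℝ} {B L : ℝ}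

theorem IsRegular.hasGradientAt_localLoss (hf : IsRegular f B L) (v : Fin m) (x : Param n) :
    HasGradientAt (localLoss f v) ((1 / (M : ℝ)) • ∑ s, gradient (f v s) x) x :=
  hasGradientAt_average _ fun s => (hf.diff v s x).hasGradientAt

theorem IsRegular.gradient_localLoss (hf : IsRegular f B L) (v : Fin m) (x : Param n) :
    gradient (localLoss f v) x = (1 / (M : ℝ)) • ∑ s, gradient (f v s) x :=
  (hf.hasGradientAt_localLoss v x).gradient

theorem IsRegular.hasGradientAt_objective (hf : IsRegular f B L) (x : Param n) :
    HasGradientAt (objective f) ((1 / (m : ℝ)) • ∑ v, gradient (localLoss f v) x) x :=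
  hasGradientAt_average _ fun v => (hf.hasGradientAt_localLoss v x).differentiableAt.hasGradientAt

theorem IsRegular.gradient_objective (hf : IsRegular f B L) (x : Param n) :
    gradient (objective f) x = (1 / (m : ℝ)) • ∑ v, gradient (localLoss f v) x :=
  (hf.hasGradientAt_objective x).gradient

theorem IsRegular.norm_gradient_objective_le (hf : IsRegular f B L) (hm : 0 < m) (hM : 0 < M)
    (x : Param n) : ‖gradient (objective f) x‖ ≤ B := by
  rw [hf.gradient_objective]
  refine norm_average_le hm fun v => ?_
  rw [hf.gradient_localLoss]
  exact norm_average_le hM fun s => hf.bound v s x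

theorem IsRegular.norm_gradient_objective_sub_le (hf : IsRegular f B L) (hm : 0 < m) (hM : 0 < M)
    (x y : Param n) :
    ‖gradient (objective f) x - gradient (objective f) y‖ ≤ L * ‖x - y‖ := by
  rw [hf.gradient_objective, hf.gradient_objective, ← smul_sub, ← Finset.sum_sub_distrib]
  refine norm_average_le hm fun v => ?_
  rw [hf.gradient_localLoss, hf.gradient_localLoss, ← smul_sub, ← Finset.sum_sub_distrib]
  exact norm_average_le hM fun s => hf.lip v s x y

/-- The inner product of the gradient of the objective with the solution of the Poisson equation
of the component gradients of node `v`. -/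
def corrector (f : Fin m → Fin M → Param n → ℝ) (G : Matrix (Fin M) (Fin M) ℝ) (v : Fin m)
    (s : Fin M) (x : Param n) : ℝ :=
  ⟪gradient (objective f) x, ∑ t, G s t • gradient (f v t) x⟫_ℝ

theorem norm_sum_smul_le {E ι : Type*} [NormedAddCommGroup E] [NormedSpace ℝ E] [Fintype ι]
    {a : ι → ℝ} {u : ι → E} {K c : ℝ} (ha : ∑ t, |a t| ≤ K) (hc : 0 ≤ c) (hu : ∀ t, ‖u t‖ ≤ c) :
    ‖∑ t, a t • u t‖ ≤ K * c := by
  calc _ ≤ ∑ t, ‖a t • u t‖ := norm_sum_le _ _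
    _ ≤ ∑ t, |a t| * c := Finset.sum_le_sum fun t _ => by
        rw [norm_smul, Real.norm_eq_abs]
        exact mul_le_mul_of_nonneg_left (hu t) (abs_nonneg _)
    _ ≤ K * c := by rw [← Finset.sum_mul]; exact mul_le_mul_of_nonneg_right ha hc

variable {G : Matrix (Fin M) (Fin M) ℝ} {K : ℝ}

theorem IsRegular.abs_corrector_le (hf : IsRegular f B L) (hm : 0 < m) (hM : 0 < M)
    (hG : ∀ s, ∑ t, |G s t| ≤ K) (v : Fin m) (s : Fin M) (x : Param n) :
    |corrector f G v s x| ≤ B ^ 2 * K := by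
  refine (abs_real_inner_le_norm _ _).trans ?_
  have h := norm_sum_smul_le (hG s) hf.bound_nonneg fun t => hf.bound v t x
  calc _ ≤ B * (K * B) := mul_le_mul (hf.norm_gradient_objective_le hm hM x) h (norm_nonneg _)
        hf.bound_nonneg
    _ = _ := by ring

theorem IsRegular.corrector_sub_le (hf : IsRegular f B L) (hm : 0 < m) (hM : 0 < M)
    (hG : ∀ s, ∑ t, |G s t| ≤ K) (v : Fin m) (s : Fin M) (x y : Param n) :
    corrector f G v s x - corrector f G v s y ≤ 2 * L * B * K * ‖x - y‖ := by
  have h1 := norm_sum_smul_le (hG s) hf.bound_nonneg fun t => hf.bound v t x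
  have h2 := norm_sum_smul_le (hG s) (mul_nonneg hf.lip_nonneg (norm_nonneg _))
    fun t => hf.lip v t x y
  have e : corrector f G v s x - corrector f G v s y =
      ⟪gradient (objective f) x - gradient (objective f) y, ∑ t, G s t • gradient (f v t) x⟫_ℝ +
      ⟪gradient (objective f) y,
        ∑ t, G s t • (gradient (f v t) x - gradient (f v t) y)⟫_ℝ := by
    simp only [corrector, smul_sub, Finset.sum_sub_distrib, inner_sub_left, inner_sub_right]
    ring
  rw [e]
  have h3 := (real_inner_le_norm (gradient (objective f) x - gradient (objective f) y)
    (∑ t, G s t • gradient (f v t) x)).trans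
    (mul_le_mul (hf.norm_gradient_objective_sub_le hm hM x y) h1 (norm_nonneg _)
      (mul_nonneg hf.lip_nonneg (norm_nonneg _)))
  have h4 := (real_inner_le_norm (gradient (objective f) y)
    (∑ t, G s t • (gradient (f v t) x - gradient (f v t) y))).trans
    (mul_le_mul (hf.norm_gradient_objective_le hm hM y) h2 (norm_nonneg _) hf.bound_nonneg)
  linarith

/-- The Poisson equation for the corrector. -/
theorem IsRegular.corrector_sub_sum (hf : IsRegular f B L) {H : Matrix (Fin M) (Fin M) ℝ}
    (hG : G - H * G = 1 - averaging M) (v : Fin m) (s : Fin M) (x : Param n) :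
    corrector f G v s x - ∑ t, H s t * corrector f G v t x =
      ⟪gradient (objective f) x, gradient (f v s) x - gradient (localLoss f v) x⟫_ℝ := by
  simp only [corrector, ← inner_smul_right, ← inner_sum, ← inner_sub_right]
  congr 1
  have h1 : ∑ t, H s t • ∑ u, G t u • gradient (f v u) x =
      ∑ u, (H * G) s u • gradient (f v u) x := by
    simp only [Finset.smul_sum, smul_smul]
    rw [Finset.sum_comm]
    simp only [← Finset.sum_smul, Matrix.mul_apply]
  rw [h1, ← Finset.sum_sub_distrib]
  simp only [← sub_smul]
  have h2 : ∀ u, G s u - (H * G) s u = (1 : Matrix (Fin M) (Fin M) ℝ) s u - 1 / M := fun u => by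
    have := congrFun (congrFun hG s) u
    simpa [averaging] using this
  simp only [h2, sub_smul, Finset.sum_sub_distrib]
  rw [hf.gradient_localLoss, Finset.smul_sum]
  simp [Matrix.one_apply]

end Objective

section Iterate

variable {m M n : ℕ} {W : Matrix (Fin m) (Fin m) ℝ} {γ : ℕ → ℝ}
  {f : Fin m → Fin M → Param n → ℝ} {x₀ : Param n} {j : ℕ → Fin m → Fin M}

/-- The gradient that node `v` samples at step `k`. -/
def sampledGradient (W : Matrix (Fin m) (Fin m) ℝ) (γ : ℕ → ℝ)
    (f : Fin m → Fin M → Param n → ℝ) (x₀ : Param n) (j : ℕ → Fin m → Fin M) (k : ℕ)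
    (v : Fin m) : Param n :=
  gradient (f v (j k v)) (iterate W γ f x₀ j k v)

theorem iterate_eq_sub_sum (hW : W ∈ doublyStochastic ℝ (Fin m)) (k : ℕ) (v : Fin m) :
    iterate W γ f x₀ j k v = x₀ - ∑ i ∈ Finset.range k,
      γ i • ∑ l, (W ^ (k - 1 - i)) v l • sampledGradient W γ f x₀ j i l := by
  induction k generalizing v with
  | zero => simp [iterate]
  | succ k ih =>
    have h1 : iterate W γ f x₀ j (k + 1) v = (∑ l, W v l • iterate W γ f x₀ j k l) -
        γ k • sampledGradient W γ f x₀ j k v := rfl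
    rw [h1, Finset.sum_range_succ]
    simp only [ih, smul_sub, Finset.sum_sub_distrib, ← Finset.sum_smul,
      sum_row_of_mem_doublyStochastic hW, one_smul]
    have h2 : k + 1 - 1 - k = 0 := by omega
    rw [sub_sub, h2]
    congr 2
    · simp only [Finset.smul_sum]
      rw [Finset.sum_comm]
      refine Finset.sum_congr rfl fun i hi => ?_
      rw [Finset.sum_comm]
      refine Finset.sum_congr rfl fun p _ => ?_
      have h3 : k + 1 - 1 - i = (k - 1 - i) + 1 := by
        have := Finset.mem_range.1 hi
        omega
      rw [h3, pow_succ', Matrix.mul_apply, Finset.sum_smul, Finset.smul_sum]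
      refine Finset.sum_congr rfl fun l _ => ?_
      simp only [smul_smul]
      congr 1
      ring
    · simp [Matrix.one_apply]

theorem nodeAverage_iterate_eq_sub_sum (hm : 0 < m) (hW : W ∈ doublyStochastic ℝ (Fin m)) (k : ℕ) :
    nodeAverage (iterate W γ f x₀ j k) = x₀ - ∑ i ∈ Finset.range k,
      γ i • ((1 / (m : ℝ)) • ∑ l, sampledGradient W γ f x₀ j i l) := by
  have hm' : (m : ℝ) ≠ 0 := by exact_mod_cast hm.ne'
  simp only [nodeAverage, iterate_eq_sub_sum hW, Finset.sum_sub_distrib, smul_sub]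
  congr 1
  · simp [← Nat.cast_smul_eq_nsmul ℝ, smul_smul, hm']
  · rw [Finset.sum_comm, Finset.smul_sum]
    refine Finset.sum_congr rfl fun i _ => ?_
    rw [← Finset.smul_sum, smul_comm, Finset.sum_comm]
    congr 2
    refine Finset.sum_congr rfl fun l _ => ?_
    rw [← Finset.sum_smul, sum_col_of_mem_doublyStochastic (pow_mem hW _), one_smul]

theorem nodeAverage_iterate_succ (hm : 0 < m) (hW : W ∈ doublyStochastic ℝ (Fin m)) (k : ℕ) :
    nodeAverage (iterate W γ f x₀ j (k + 1)) = nodeAverage (iterate W γ f x₀ j k) -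
      γ k • ((1 / (m : ℝ)) • ∑ l, sampledGradient W γ f x₀ j k l) := by
  rw [nodeAverage_iterate_eq_sub_sum hm hW, nodeAverage_iterate_eq_sub_sum hm hW,
    Finset.sum_range_succ, sub_sub]

variable {B L : ℝ}

theorem IsRegular.norm_nodeAverage_succ_sub_le (hf : IsRegular f B L) (hγ : ∀ k, 0 ≤ γ k)
    (hm : 0 < m) (hW : W ∈ doublyStochastic ℝ (Fin m)) (k : ℕ) :
    ‖nodeAverage (iterate W γ f x₀ j (k + 1)) - nodeAverage (iterate W γ f x₀ j k)‖ ≤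
      B * γ k := by
  rw [nodeAverage_iterate_succ hm hW, sub_sub_cancel_left, norm_neg, norm_smul,
    Real.norm_of_nonneg (hγ k), mul_comm]
  exact mul_le_mul_of_nonneg_right (norm_average_le hm fun v => hf.bound v _ _) (hγ k)

/-- A bound of the distance of node `v` from the node average, for gradients of norm one. -/
def consensusBound (W : Matrix (Fin m) (Fin m) ℝ) (γ : ℕ → ℝ) (v : Fin m) (k : ℕ) : ℝ :=
  ∑ i ∈ Finset.range k, γ i * ∑ l, |(W ^ (k - 1 - i) - averaging m) v l|

theorem IsRegular.norm_iterate_sub_nodeAverage_le (hf : IsRegular f B L) (hγ : ∀ k, 0 ≤ γ k)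
    (hm : 0 < m) (hW : W ∈ doublyStochastic ℝ (Fin m)) (k : ℕ) (v : Fin m) :
    ‖iterate W γ f x₀ j k v - nodeAverage (iterate W γ f x₀ j k)‖ ≤
      B * consensusBound W γ v k := by
  have e : iterate W γ f x₀ j k v - nodeAverage (iterate W γ f x₀ j k) =
      -∑ i ∈ Finset.range k, γ i • ∑ l, (W ^ (k - 1 - i) - averaging m) v l •
        sampledGradient W γ f x₀ j i l := by
    rw [nodeAverage_iterate_eq_sub_sum hm hW, iterate_eq_sub_sum hW, sub_sub_sub_cancel_left,
      ← Finset.sum_sub_distrib, ← Finset.sum_neg_distrib]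
    refine Finset.sum_congr rfl fun i _ => ?_
    rw [← smul_sub, ← smul_neg]
    congr 1
    simp [averaging, sub_smul, Finset.sum_sub_distrib, Finset.smul_sum]
  rw [e, norm_neg, consensusBound, Finset.mul_sum]
  refine (norm_sum_le _ _).trans (Finset.sum_le_sum fun i _ => ?_)
  rw [norm_smul, Real.norm_of_nonneg (hγ i), mul_left_comm, mul_comm B]
  exact mul_le_mul_of_nonneg_left
    (norm_sum_smul_le le_rfl hf.bound_nonneg fun l => hf.bound l _ _) (hγ i)

variable {G H : Matrix (Fin M) (Fin M) ℝ}

/-- One step of the averaged iteration, along a trajectory of the chains. -/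
theorem IsRegular.descent_step (hf : IsRegular f B L) (hγ : ∀ k, 0 ≤ γ k) (hm : 0 < m)
    (hM : 0 < M) (hW : W ∈ doublyStochastic ℝ (Fin m)) (hG : G - H * G = 1 - averaging M)
    (k : ℕ) :
    γ k * ‖gradient (objective f) (nodeAverage (iterate W γ f x₀ j k))‖ ^ 2 ≤
      objective f (nodeAverage (iterate W γ f x₀ j k)) -
        objective f (nodeAverage (iterate W γ f x₀ j (k + 1))) +
      L * B ^ 2 * γ k ^ 2 +
      B ^ 2 * L * ((1 / (m : ℝ)) * ∑ v, γ k * consensusBound W γ v k) +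
      γ k * ((1 / (m : ℝ)) * ∑ v,
        (∑ t, H (j k v) t * corrector f G v t (nodeAverage (iterate W γ f x₀ j k)) -
          corrector f G v (j k v) (nodeAverage (iterate W γ f x₀ j k)))) := by
  set y := nodeAverage (iterate W γ f x₀ j k) with hy
  set g := gradient (objective f) y with hg
  have hm' : (0 : ℝ) < m := by exact_mod_cast hm
  have h1 := le_add_inner_gradient (fun x => (hf.hasGradientAt_objective x).differentiableAt)
    hf.lip_nonneg (hf.norm_gradient_objective_sub_le hm hM) y
    (nodeAverage (iterate W γ f x₀ j (k + 1)))
  have h2 := hf.norm_nodeAverage_succ_sub_le (x₀ := x₀) (j := j) hγ hm hW k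
  have h3 : L * ‖nodeAverage (iterate W γ f x₀ j (k + 1)) - y‖ ^ 2 ≤ L * B ^ 2 * γ k ^ 2 := by
    rw [mul_assoc, ← mul_pow]
    exact mul_le_mul_of_nonneg_left (pow_le_pow_left₀ (norm_nonneg _) h2 2) hf.lip_nonneg
  have h4 : ⟪g, nodeAverage (iterate W γ f x₀ j (k + 1)) - y⟫_ℝ =
      -(γ k * ((1 / (m : ℝ)) * ∑ v, ⟪g, sampledGradient W γ f x₀ j k v⟫_ℝ)) := by
    rw [nodeAverage_iterate_succ hm hW, sub_sub_cancel_left, inner_neg_right, inner_smul_right,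
      inner_smul_right, inner_sum]
  have h5 : ‖g‖ ^ 2 = (1 / (m : ℝ)) * ∑ v, ⟪g, gradient (localLoss f v) y⟫_ℝ := by
    rw [← real_inner_self_eq_norm_sq]
    have e : g = (1 / (m : ℝ)) • ∑ v, gradient (localLoss f v) y := hf.gradient_objective y
    refine (congrArg (inner ℝ g) e).trans ?_
    rw [inner_smul_right, inner_sum]
  have h6 : ∀ v, ⟪g, gradient (localLoss f v) y⟫_ℝ - ⟪g, sampledGradient W γ f x₀ j k v⟫_ℝ ≤
      (∑ t, H (j k v) t * corrector f G v t y - corrector f G v (j k v) y) +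
        B ^ 2 * L * consensusBound W γ v k := by
    intro v
    have e := hf.corrector_sub_sum hG v (j k v) y
    have h7 : ⟪g, gradient (f v (j k v)) y - sampledGradient W γ f x₀ j k v⟫_ℝ ≤
        B * (L * (B * consensusBound W γ v k)) := by
      refine (real_inner_le_norm _ _).trans ?_
      refine mul_le_mul (hf.norm_gradient_objective_le hm hM y) ?_ (norm_nonneg _) hf.bound_nonneg
      refine (hf.lip v (j k v) _ _).trans (mul_le_mul_of_nonneg_left ?_ hf.lip_nonneg)
      rw [norm_sub_rev]
      exact hf.norm_iterate_sub_nodeAverage_le hγ hm hW k v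
    rw [inner_sub_right] at h7 e
    linarith
  have h8 := mul_le_mul_of_nonneg_left (Finset.sum_le_sum fun v (_ : v ∈ Finset.univ) => h6 v)
    (show 0 ≤ γ k * (1 / (m : ℝ)) from mul_nonneg (hγ k) (by positivity))
  rw [Finset.sum_sub_distrib, Finset.sum_add_distrib, ← Finset.mul_sum] at h8
  rw [h5, ← Finset.mul_sum]
  linarith

/-- The iterates at time `k` depend on the states before time `k` only. -/
theorem iterate_congr {j j' : ℕ → Fin m → Fin M} {k : ℕ} (h : ∀ i < k, j i = j' i) :
    iterate W γ f x₀ j k = iterate W γ f x₀ j' k := by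
  induction k with
  | zero => rfl
  | succ k ih =>
    ext1 v
    simp only [iterate, ih fun i hi => h i (by omega), h k (by omega)]

end Iterate

section History

variable {m M : ℕ} {Ω : Type*} {j : ℕ → Fin m → Ω → Fin M}

/-- The states of all nodes up to time `k`. -/
def history (j : ℕ → Fin m → Ω → Fin M) (k : ℕ) (ω : Ω) : Fin (k + 1) → Fin m → Fin M :=
  fun i v => j i v ω

/-- The trajectory that follows a finite history and then stays at its last state. -/
def extend {k : ℕ} (h : Fin (k + 1) → Fin m → Fin M) : ℕ → Fin m → Fin M :=
  fun i => h ⟨min i k, by omega⟩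

/-- `Φ` is determined by the states up to time `k`. -/
def DependsOnPast {α : Type*} (k : ℕ) (Φ : (ℕ → Fin m → Fin M) → α) : Prop :=
  ∀ a b, (∀ i ≤ k, a i = b i) → Φ a = Φ b

theorem DependsOnPast.eq_extend {α : Type*} {k : ℕ} {Φ : (ℕ → Fin m → Fin M) → α}
    (hΦ : DependsOnPast k Φ) (ω : Ω) :
    Φ (fun i v => j i v ω) = Φ (extend (history j k ω)) := by
  refine hΦ _ _ fun i hi => ?_
  ext v
  simp [extend, history, min_eq_left hi]

variable [MeasurableSpace Ω] {μ : Measure Ω} {H : Matrix (Fin M) (Fin M) ℝ}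

theorem IsMarkovSampling.measurable_history (hj : IsMarkovSampling μ H j) (k : ℕ) :
    Measurable (history j k) :=
  measurable_pi_lambda _ fun i => measurable_pi_lambda _ fun v => hj.measurable i v

theorem IsMarkovSampling.integrable [IsFiniteMeasure μ] (hj : IsMarkovSampling μ H j) {k : ℕ}
    {Φ : (ℕ → Fin m → Fin M) → ℝ} (hΦ : DependsOnPast k Φ) :
    Integrable (fun ω => Φ (fun i v => j i v ω)) μ := by
  simp only [hΦ.eq_extend]
  exact (Integrable.of_finite (f := fun h => Φ (extend h))).comp_measurable
    (hj.measurable_history k)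

theorem IsMarkovSampling.integral_eq_sum [IsFiniteMeasure μ] (hj : IsMarkovSampling μ H j) {k : ℕ}
    {Φ : (ℕ → Fin m → Fin M) → ℝ} (hΦ : DependsOnPast k Φ) :
    ∫ ω, Φ (fun i v => j i v ω) ∂μ =
      ∑ h, μ.real (history j k ⁻¹' {h}) * Φ (extend h) := by
  simp only [hΦ.eq_extend]
  rw [← integral_map (f := fun h => Φ (extend h)) (hj.measurable_history k).aemeasurable
    (Measurable.of_discrete.aestronglyMeasurable), integral_fintype Integrable.of_finite]
  refine Finset.sum_congr rfl fun h _ => ?_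
  rw [map_measureReal_apply (hj.measurable_history k) (measurableSet_singleton h), smul_eq_mul]

/-- Averaging over the next state of node `v`, given the past. -/
theorem IsMarkovSampling.integral_next [IsFiniteMeasure μ] (hj : IsMarkovSampling μ H j) {k : ℕ}
    {Φ : (ℕ → Fin m → Fin M) → Fin M → ℝ} (hΦ : ∀ t, DependsOnPast k fun a => Φ a t) (v : Fin m) :
    ∫ ω, Φ (fun i u => j i u ω) (j (k + 1) v ω) ∂μ =
      ∫ ω, ∑ t, H (j k v ω) t * Φ (fun i u => j i u ω) t ∂μ := by
  have hR : DependsOnPast k fun a : ℕ → Fin m → Fin M => ∑ t, H (a k v) t * Φ a t := by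
    intro a b h
    refine Finset.sum_congr rfl fun t _ => ?_
    rw [h k le_rfl, show Φ a t = Φ b t from hΦ t a b h]
  rw [hj.integral_eq_sum hR]
  let X : Ω → (Fin (k + 1) → Fin m → Fin M) × Fin M := fun ω => (history j k ω, j (k + 1) v ω)
  have hX : Measurable X := (hj.measurable_history k).prodMk (hj.measurable (k + 1) v)
  have e : ∀ ω, Φ (fun i u => j i u ω) (j (k + 1) v ω) =
      (fun p : (Fin (k + 1) → Fin m → Fin M) × Fin M => Φ (extend p.1) p.2) (X ω) := fun ω =>
    (hΦ (j (k + 1) v ω)).eq_extend ω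
  simp only [e]
  rw [← integral_map (f := fun p : (Fin (k + 1) → Fin m → Fin M) × Fin M => Φ (extend p.1) p.2)
    hX.aemeasurable Measurable.of_discrete.aestronglyMeasurable,
    integral_fintype Integrable.of_finite, Fintype.sum_prod_type]
  refine Finset.sum_congr rfl fun h _ => ?_
  rw [Finset.mul_sum]
  refine Finset.sum_congr rfl fun t _ => ?_
  rw [map_measureReal_apply hX (measurableSet_singleton _), smul_eq_mul, ← mul_assoc]
  congr 1
  have hpast : ∀ ω, (∀ i ≤ k, ∀ u, j i u ω = extend h i u) ↔ history j k ω = h := by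
    intro ω
    constructor
    · intro hi
      ext i u
      have hik : (i : ℕ) ≤ k := Nat.lt_succ_iff.1 i.2
      have := hi i hik u
      simp only [extend, min_eq_left hik] at this
      simp [history, this]
    · rintro rfl i hi u
      simp [extend, history, min_eq_left hi]
  have h1 := hj.markov k (extend h) v t
  simp only [hpast] at h1
  have h2 : X ⁻¹' {(h, t)} = {ω | history j k ω = h ∧ j (k + 1) v ω = t} := by
    ext ω
    simp [X]
  rw [h2, h1]
  rfl

end History

section Expectation

variable {m M n : ℕ} {W : Matrix (Fin m) (Fin m) ℝ} {γ : ℕ → ℝ}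
  {f : Fin m → Fin M → Param n → ℝ} {x₀ : Param n}

theorem dependsOnPast_iterate {k k' : ℕ} (h : k ≤ k' + 1) :
    DependsOnPast k' fun a : ℕ → Fin m → Fin M => iterate W γ f x₀ a k := fun _ _ hab =>
  iterate_congr fun i hi => hab i (by omega)

theorem dependsOnPast_comp_iterate {α : Type*} {k k' : ℕ} (h : k ≤ k' + 1) (F : Param n → α) :
    DependsOnPast k' fun a : ℕ → Fin m → Fin M => F (nodeAverage (iterate W γ f x₀ a k)) :=
  fun a b hab => by
    dsimp only
    rw [show iterate W γ f x₀ a k = iterate W γ f x₀ b k from dependsOnPast_iterate h a b hab]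

/-- The node average of the corrector at the states `a i` and the node average of the iterate
`k`. -/
def meanCorrector (W : Matrix (Fin m) (Fin m) ℝ) (γ : ℕ → ℝ) (f : Fin m → Fin M → Param n → ℝ)
    (x₀ : Param n) (G : Matrix (Fin M) (Fin M) ℝ) (i k : ℕ) (a : ℕ → Fin m → Fin M) : ℝ :=
  (1 / (m : ℝ)) * ∑ v, corrector f G v (a i v) (nodeAverage (iterate W γ f x₀ a k))

variable {G : Matrix (Fin M) (Fin M) ℝ}

theorem dependsOnPast_corrector {i k k' : ℕ} (hi : i ≤ k') (h : k ≤ k' + 1) (v : Fin m) :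
    DependsOnPast k' fun a : ℕ → Fin m → Fin M =>
      corrector f G v (a i v) (nodeAverage (iterate W γ f x₀ a k)) := fun a b hab => by
  dsimp only
  rw [show iterate W γ f x₀ a k = iterate W γ f x₀ b k from dependsOnPast_iterate h a b hab,
    hab i hi]

theorem dependsOnPast_meanCorrector {i k k' : ℕ} (hi : i ≤ k') (h : k ≤ k' + 1) :
    DependsOnPast k' (meanCorrector W γ f x₀ G i k) := fun a b hab => by
  simp only [meanCorrector]
  congr 1
  exact Finset.sum_congr rfl fun v _ => dependsOnPast_corrector hi h v a b hab

variable {Ω : Type*} [MeasurableSpace Ω] {μ : Measure Ω} {H : Matrix (Fin M) (Fin M) ℝ}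
  {j : ℕ → Fin m → Ω → Fin M} {B L K : ℝ}

theorem IsMarkovSampling.integral_meanCorrector_next [IsFiniteMeasure μ]
    (hj : IsMarkovSampling μ H j) (k : ℕ) :
    ∫ ω, meanCorrector W γ f x₀ G (k + 1) k (fun i v => j i v ω) ∂μ =
      ∫ ω, (1 / (m : ℝ)) * ∑ v, ∑ t, H (j k v ω) t *
        corrector f G v t (nodeAverage (iterate W γ f x₀ (fun i v => j i v ω) k)) ∂μ := by
  have hdep : ∀ v, DependsOnPast k fun a : ℕ → Fin m → Fin M =>
      ∑ t, H (a k v) t * corrector f G v t (nodeAverage (iterate W γ f x₀ a k)) := by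
    intro v a b hab
    dsimp only
    rw [show iterate W γ f x₀ a k = iterate W γ f x₀ b k from
      dependsOnPast_iterate (Nat.le_succ k) a b hab]
    simp only [hab k le_rfl]
  simp only [meanCorrector]
  rw [integral_const_mul, integral_const_mul, integral_finsetSum _ fun v _ =>
    hj.integrable (dependsOnPast_corrector (le_refl (k + 1)) (by omega) v),
    integral_finsetSum _ fun v _ => hj.integrable (hdep v)]
  congr 1
  refine Finset.sum_congr rfl fun v _ => ?_
  exact hj.integral_next (Φ := fun a t =>
    corrector f G v t (nodeAverage (iterate W γ f x₀ a k)))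
    (fun t => dependsOnPast_comp_iterate (Nat.le_succ k) _) v

theorem integral_linear_combination [IsProbabilityMeasure μ] {g₁ g₂ g₃ g₄ : Ω → ℝ}
    (h₁ : Integrable g₁ μ) (h₂ : Integrable g₂ μ) (h₃ : Integrable g₃ μ) (h₄ : Integrable g₄ μ)
    (c r : ℝ) :
    ∫ ω, (g₁ ω - g₂ ω + c + r * (g₃ ω - g₄ ω)) ∂μ =
      (∫ ω, g₁ ω ∂μ) - (∫ ω, g₂ ω ∂μ) + c + r * ((∫ ω, g₃ ω ∂μ) - ∫ ω, g₄ ω ∂μ) := by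
  rw [integral_add (f := fun ω => g₁ ω - g₂ ω + c)
    (g := fun ω => r * (g₃ ω - g₄ ω)) ((h₁.sub h₂).add (integrable_const c))
    ((h₃.sub h₄).const_mul r), integral_add (f := fun ω => g₁ ω - g₂ ω) (h₁.sub h₂)
    (integrable_const c), integral_sub h₁ h₂, integral_const_mul, integral_sub h₃ h₄]
  simp

theorem IsRegular.expected_descent_step [IsProbabilityMeasure μ] (hf : IsRegular f B L)
    (hγ : ∀ k, 0 ≤ γ k) (hm : 0 < m) (hM : 0 < M) (hW : W ∈ doublyStochastic ℝ (Fin m))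
    (hG : G - H * G = 1 - averaging M) (hGK : ∀ s, ∑ t, |G s t| ≤ K)
    (hj : IsMarkovSampling μ H j) (k : ℕ) :
    γ k * ∫ ω, ‖gradient (objective f)
        (nodeAverage (iterate W γ f x₀ (fun i v => j i v ω) k))‖ ^ 2 ∂μ ≤
      (∫ ω, objective f (nodeAverage (iterate W γ f x₀ (fun i v => j i v ω) k)) ∂μ) -
        (∫ ω, objective f (nodeAverage (iterate W γ f x₀ (fun i v => j i v ω) (k + 1))) ∂μ) +
      (L * B ^ 2 + 2 * L * B ^ 2 * K) * γ k ^ 2 +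
      B ^ 2 * L * ((1 / (m : ℝ)) * ∑ v, γ k * consensusBound W γ v k) +
      γ k * ((∫ ω, meanCorrector W γ f x₀ G (k + 1) (k + 1) (fun i v => j i v ω) ∂μ) -
        ∫ ω, meanCorrector W γ f x₀ G k k (fun i v => j i v ω) ∂μ) := by
  have hm' : (m : ℝ) ≠ 0 := by exact_mod_cast hm.ne'
  have hdep : DependsOnPast k fun a : ℕ → Fin m → Fin M => (1 / (m : ℝ)) * ∑ v, ∑ t,
      H (a k v) t * corrector f G v t (nodeAverage (iterate W γ f x₀ a k)) := by
    intro a b hab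
    dsimp only
    rw [show iterate W γ f x₀ a k = iterate W γ f x₀ b k from
      dependsOnPast_iterate (Nat.le_succ k) a b hab]
    simp only [hab k le_rfl]
  have iF := hj.integrable (dependsOnPast_comp_iterate (W := W) (γ := γ) (f := f) (x₀ := x₀)
    (Nat.le_succ k) (objective f))
  have iF' := hj.integrable (dependsOnPast_comp_iterate (W := W) (γ := γ) (f := f) (x₀ := x₀)
    (le_refl (k + 1)) (objective f))
  have iG := hj.integrable (dependsOnPast_comp_iterate (W := W) (γ := γ) (f := f) (x₀ := x₀)
    (Nat.le_succ k) fun x => ‖gradient (objective f) x‖ ^ 2)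
  have iH := hj.integrable hdep
  have i0 := hj.integrable (dependsOnPast_meanCorrector (W := W) (γ := γ) (f := f) (x₀ := x₀)
    (G := G) (le_refl k) (Nat.le_succ k))
  have i1 := hj.integrable (dependsOnPast_meanCorrector (W := W) (γ := γ) (f := f) (x₀ := x₀)
    (G := G) (le_refl (k + 1)) (show k ≤ k + 1 + 1 by omega))
  have i2 := hj.integrable (dependsOnPast_meanCorrector (W := W) (γ := γ) (f := f) (x₀ := x₀)
    (G := G) (le_refl (k + 1)) (show k + 1 ≤ k + 1 + 1 by omega))
  have hshift : ∫ ω, meanCorrector W γ f x₀ G (k + 1) k (fun i v => j i v ω) ∂μ ≤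
      (∫ ω, meanCorrector W γ f x₀ G (k + 1) (k + 1) (fun i v => j i v ω) ∂μ) +
        2 * L * B ^ 2 * K * γ k := by
    have hc : ∫ _, 2 * L * B ^ 2 * K * γ k ∂μ = 2 * L * B ^ 2 * K * γ k := by simp
    rw [← hc, ← integral_add i2 (integrable_const _)]
    refine integral_mono i1 (i2.add (integrable_const _)) fun ω => ?_
    have h1 : ∀ v s, corrector f G v s
        (nodeAverage (iterate W γ f x₀ (fun i v => j i v ω) k)) ≤ corrector f G v s
        (nodeAverage (iterate W γ f x₀ (fun i v => j i v ω) (k + 1))) +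
          2 * L * B ^ 2 * K * γ k := by
      intro v s
      have hK : 0 ≤ K := (Finset.sum_nonneg fun _ _ => abs_nonneg _).trans (hGK s)
      have h2 := hf.corrector_sub_le hm hM hGK v s
        (nodeAverage (iterate W γ f x₀ (fun i v => j i v ω) k))
        (nodeAverage (iterate W γ f x₀ (fun i v => j i v ω) (k + 1)))
      have h3 := hf.norm_nodeAverage_succ_sub_le (x₀ := x₀) (j := fun i v => j i v ω) hγ hm hW k
      rw [norm_sub_rev] at h3
      have hc : 0 ≤ 2 * L * B * K :=
        mul_nonneg (mul_nonneg (mul_nonneg two_pos.le hf.lip_nonneg) hf.bound_nonneg) hK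
      have h4 := mul_le_mul_of_nonneg_left h3 hc
      linarith
    calc _ ≤ (1 / (m : ℝ)) * ∑ v, (corrector f G v (j (k + 1) v ω)
          (nodeAverage (iterate W γ f x₀ (fun i v => j i v ω) (k + 1))) +
            2 * L * B ^ 2 * K * γ k) :=
          mul_le_mul_of_nonneg_left (Finset.sum_le_sum fun v _ => h1 v _) (by positivity)
      _ = _ := by
          rw [Finset.sum_add_distrib, mul_add]
          simp [meanCorrector, hm']
  have hmain : ∫ ω, γ k * ‖gradient (objective f)
        (nodeAverage (iterate W γ f x₀ (fun i v => j i v ω) k))‖ ^ 2 ∂μ ≤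
      ∫ ω, ((objective f (nodeAverage (iterate W γ f x₀ (fun i v => j i v ω) k)) -
        objective f (nodeAverage (iterate W γ f x₀ (fun i v => j i v ω) (k + 1)))) +
        (L * B ^ 2 * γ k ^ 2 +
          B ^ 2 * L * ((1 / (m : ℝ)) * ∑ v, γ k * consensusBound W γ v k)) +
        γ k * ((1 / (m : ℝ)) * (∑ v, ∑ t, H (j k v ω) t *
          corrector f G v t (nodeAverage (iterate W γ f x₀ (fun i v => j i v ω) k))) -
          meanCorrector W γ f x₀ G k k (fun i v => j i v ω))) ∂μ := by
    refine integral_mono (iG.const_mul _) (((iF.sub iF').add (integrable_const _)).add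
      ((iH.sub i0).const_mul _)) fun ω => ?_
    refine (hf.descent_step (x₀ := x₀) (j := fun i v => j i v ω) hγ hm hM hW hG k).trans
      (le_of_eq ?_)
    simp only [meanCorrector, Finset.sum_sub_distrib, mul_sub]
    ring
  rw [integral_const_mul, integral_linear_combination iF iF' iH i0,
    ← hj.integral_meanCorrector_next k] at hmain
  have h5 := mul_le_mul_of_nonneg_left hshift (hγ k)
  linarith

theorem sq_integral_le [IsProbabilityMeasure μ] {g : Ω → ℝ} (hg : Integrable g μ)
    (hg2 : Integrable (fun ω => g ω ^ 2) μ) : (∫ ω, g ω ∂μ) ^ 2 ≤ ∫ ω, g ω ^ 2 ∂μ := by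
  set c := ∫ ω, g ω ∂μ with hc
  have h : 0 ≤ ∫ ω, (g ω ^ 2 - 2 * c * g ω + c ^ 2 + 0 * (g ω - g ω)) ∂μ :=
    integral_nonneg fun ω => by
      change 0 ≤ g ω ^ 2 - 2 * c * g ω + c ^ 2 + 0 * (g ω - g ω)
      nlinarith [sq_nonneg (g ω - c)]
  rw [integral_linear_combination hg2 (hg.const_mul (2 * c)) hg hg, integral_const_mul, ← hc] at h
  linarith

theorem IsRegular.sum_mul_sq_le [IsProbabilityMeasure μ] (hf : IsRegular f B L)
    (hγ : ∀ k, 0 ≤ γ k) (hγa : Antitone γ) {S : ℝ}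
    (hS : ∀ N, ∑ k ∈ Finset.range N, γ k ^ 2 ≤ S) (hm : 0 < m) (hM : 0 < M)
    (hW : W ∈ doublyStochastic ℝ (Fin m)) {K' : ℝ}
    (hWK : ∀ N v, ∑ k ∈ Finset.range N, ∑ l, |(W ^ k - averaging m) v l| ≤ K')
    (hG : G - H * G = 1 - averaging M) (hGK : ∀ s, ∑ t, |G s t| ≤ K)
    (hj : IsMarkovSampling μ H j) {Δ : ℝ} (hΔ : ∀ y, objective f x₀ - objective f y ≤ Δ) (N : ℕ) :
    ∑ k ∈ Finset.range N, γ k * (∫ ω, ‖gradient (objective f)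
        (nodeAverage (iterate W γ f x₀ (fun i v => j i v ω) k))‖ ∂μ) ^ 2 ≤
      Δ + (L * B ^ 2 + 2 * L * B ^ 2 * K) * S + B ^ 2 * L * (K' * S) +
        2 * (B ^ 2 * K) * γ 0 := by
  have hm' : (m : ℝ) ≠ 0 := by exact_mod_cast hm.ne'
  have hK : 0 ≤ K := (Finset.sum_nonneg fun _ _ => abs_nonneg _).trans (hGK ⟨0, hM⟩)
  have hK' : 0 ≤ K' := (Finset.sum_nonneg fun _ _ =>
    Finset.sum_nonneg fun _ _ => abs_nonneg _).trans (hWK 0 ⟨0, hm⟩)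
  have hL := hf.lip_nonneg
  set e := fun k => ∫ ω, objective f (nodeAverage (iterate W γ f x₀ (fun i v => j i v ω) k)) ∂μ
    with he
  set Φ := fun k => ∫ ω, meanCorrector W γ f x₀ G k k (fun i v => j i v ω) ∂μ with hΦ
  have hstep : ∀ k, γ k * (∫ ω, ‖gradient (objective f)
        (nodeAverage (iterate W γ f x₀ (fun i v => j i v ω) k))‖ ∂μ) ^ 2 ≤
      (e k - e (k + 1)) + (L * B ^ 2 + 2 * L * B ^ 2 * K) * γ k ^ 2 +
      B ^ 2 * L * ((1 / (m : ℝ)) * ∑ v, γ k * consensusBound W γ v k) +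
      γ k * (Φ (k + 1) - Φ k) := by
    intro k
    refine le_trans (mul_le_mul_of_nonneg_left (sq_integral_le ?_ ?_) (hγ k))
      (hf.expected_descent_step (x₀ := x₀) hγ hm hM hW hG hGK hj k)
    · exact hj.integrable (dependsOnPast_comp_iterate (Nat.le_succ k)
        fun x => ‖gradient (objective f) x‖)
    · exact hj.integrable (dependsOnPast_comp_iterate (Nat.le_succ k)
        fun x => ‖gradient (objective f) x‖ ^ 2)
  have hΦb : ∀ k, |Φ k| ≤ B ^ 2 * K := by
    intro k
    have h := norm_integral_le_of_norm_le_const (μ := μ) (C := B ^ 2 * K)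
      (f := fun ω => meanCorrector W γ f x₀ G k k (fun i v => j i v ω))
      (Eventually.of_forall fun ω => ?_)
    · rwa [probReal_univ, mul_one] at h
    have := norm_average_le hm (u := fun v => corrector f G v (j k v ω)
      (nodeAverage (iterate W γ f x₀ (fun i v => j i v ω) k))) (c := B ^ 2 * K)
      fun v => hf.abs_corrector_le hm hM hGK v _ _
    simpa [meanCorrector] using this
  have hobj : e 0 - e N ≤ Δ := by
    have i0 := hj.integrable (dependsOnPast_comp_iterate (W := W) (γ := γ) (f := f) (x₀ := x₀)
      (Nat.le_succ N) (objective f))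
    have h0 : e 0 = ∫ _, objective f x₀ ∂μ := by
      have : ∀ ω, nodeAverage (iterate W γ f x₀ (fun i v => j i v ω) 0) = x₀ := fun ω => by
        simp [nodeAverage, iterate, ← Nat.cast_smul_eq_nsmul ℝ, smul_smul, hm']
      simp only [he, this]
    rw [h0, he, ← integral_sub (integrable_const _) i0]
    calc _ ≤ ∫ _, Δ ∂μ := integral_mono ((integrable_const _).sub i0) (integrable_const _)
          fun ω => hΔ _
      _ = Δ := by simp
  have hcons : ∑ k ∈ Finset.range N, (1 / (m : ℝ)) * ∑ v, γ k * consensusBound W γ v k ≤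
      K' * S := by
    rw [← Finset.mul_sum, Finset.sum_comm]
    have h1 : ∀ v, ∑ k ∈ Finset.range N, γ k * consensusBound W γ v k ≤ K' * S := fun v =>
      (sum_convolution_le hγa hγ (fun r => Finset.sum_nonneg fun _ _ => abs_nonneg _)
        (fun N => hWK N v) N).trans (mul_le_mul_of_nonneg_left (hS N) hK')
    calc _ ≤ (1 / (m : ℝ)) * ∑ v : Fin m, K' * S :=
          mul_le_mul_of_nonneg_left (Finset.sum_le_sum fun v _ => h1 v) (by positivity)
      _ = _ := by simp [hm']
  have hab := sum_mul_sub_le hγa hγ hΦb N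
  have hsum := Finset.sum_le_sum fun k (_ : k ∈ Finset.range N) => hstep k
  simp only [Finset.sum_add_distrib, Finset.sum_range_sub', ← Finset.mul_sum _ _ (B ^ 2 * L),
    ← Finset.mul_sum _ _ (L * B ^ 2 + 2 * L * B ^ 2 * K)] at hsum
  have h6 := mul_le_mul_of_nonneg_left hcons (mul_nonneg (sq_nonneg B) hL)
  have h7 := mul_le_mul_of_nonneg_left (hS N)
    (show 0 ≤ L * B ^ 2 + 2 * L * B ^ 2 * K by positivity)
  linarith

theorem IsRegular.abs_integral_succ_sub_le [IsProbabilityMeasure μ] (hf : IsRegular f B L)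
    (hγ : ∀ k, 0 ≤ γ k) (hm : 0 < m) (hM : 0 < M) (hW : W ∈ doublyStochastic ℝ (Fin m))
    (hj : IsMarkovSampling μ H j) (k : ℕ) :
    |(∫ ω, ‖gradient (objective f)
        (nodeAverage (iterate W γ f x₀ (fun i v => j i v ω) (k + 1)))‖ ∂μ) -
      ∫ ω, ‖gradient (objective f)
        (nodeAverage (iterate W γ f x₀ (fun i v => j i v ω) k))‖ ∂μ| ≤ L * B * γ k := by
  rw [← integral_sub
    (hj.integrable (dependsOnPast_comp_iterate (le_refl (k + 1))
      fun x => ‖gradient (objective f) x‖))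
    (hj.integrable (dependsOnPast_comp_iterate (Nat.le_succ k)
      fun x => ‖gradient (objective f) x‖))]
  have h := norm_integral_le_of_norm_le_const (μ := μ) (C := L * B * γ k)
    (f := fun ω => ‖gradient (objective f)
        (nodeAverage (iterate W γ f x₀ (fun i v => j i v ω) (k + 1)))‖ -
      ‖gradient (objective f) (nodeAverage (iterate W γ f x₀ (fun i v => j i v ω) k))‖)
    (Eventually.of_forall fun ω => ?_)
  · rwa [probReal_univ, mul_one] at h
  rw [Real.norm_eq_abs, mul_assoc]
  exact (abs_norm_sub_norm_le _ _).trans ((hf.norm_gradient_objective_sub_le hm hM _ _).trans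
    (mul_le_mul_of_nonneg_left (hf.norm_nodeAverage_succ_sub_le hγ hm hW k) hf.lip_nonneg))

end Expectation

section Stepsize

variable {θ : ℝ}

theorem stepsize_eq_rpow (k : ℕ) : stepsize θ k = ((k + 1 : ℕ) : ℝ) ^ (-θ) := by
  rw [stepsize, Real.rpow_neg (by positivity), one_div]
  push_cast
  rfl

theorem stepsize_nonneg (k : ℕ) : 0 ≤ stepsize θ k := by
  rw [stepsize]
  positivity

theorem stepsize_antitone (hθ : 0 < θ) : Antitone (stepsize θ) := by
  intro a b h
  rw [stepsize, stepsize]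
  have : (a : ℝ) ≤ b := by exact_mod_cast h
  gcongr

theorem stepsize_pow (k p : ℕ) : stepsize θ k ^ p = ((k + 1 : ℕ) : ℝ) ^ (-(θ * p)) := by
  rw [stepsize_eq_rpow, ← Real.rpow_natCast, ← Real.rpow_mul (by positivity)]
  ring_nf

theorem summable_stepsize_pow {p : ℕ} (h : 1 < θ * p) : Summable fun k => stepsize θ k ^ p := by
  simp only [stepsize_pow]
  exact (summable_nat_add_iff (f := fun k : ℕ => (k : ℝ) ^ (-(θ * p))) 1).2
    (Real.summable_nat_rpow.2 (by linarith))

theorem not_summable_stepsize (h : θ < 1) : ¬ Summable (stepsize θ) := by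
  intro hs
  simp only [funext stepsize_eq_rpow] at hs
  have := Real.summable_nat_rpow.1
    ((summable_nat_add_iff (f := fun k : ℕ => (k : ℝ) ^ (-θ)) 1).1 hs)
  linarith

theorem rpow_le_sum_stepsize (hθ : 0 < θ) (hθ' : θ < 1) {k : ℕ} (hk : 1 ≤ k) :
    (k : ℝ) ^ (1 - θ) / 2 ≤ ∑ i ∈ Finset.Icc 1 k, stepsize θ i := by
  have hk' : (1 : ℝ) ≤ k := by exact_mod_cast hk
  have h1 : ∀ i ∈ Finset.Icc 1 k, (k : ℝ) ^ (-θ) / 2 ≤ stepsize θ i := by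
    intro i hi
    refine le_trans ?_ (stepsize_antitone hθ (Finset.mem_Icc.1 hi).2)
    rw [stepsize, Real.rpow_neg (by positivity), ← one_div, div_div]
    gcongr
    calc ((k : ℝ) + 1) ^ θ ≤ (k * 2) ^ θ := by gcongr; linarith
      _ = (k : ℝ) ^ θ * 2 ^ θ := Real.mul_rpow (by positivity) (by norm_num)
      _ ≤ (k : ℝ) ^ θ * 2 := by
          gcongr
          calc (2 : ℝ) ^ θ ≤ 2 ^ (1 : ℝ) := by gcongr; all_goals linarith
            _ = 2 := by simp
  calc _ = ∑ i ∈ Finset.Icc 1 k, (k : ℝ) ^ (-θ) / 2 := by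
        rw [Finset.sum_const, Nat.card_Icc, nsmul_eq_mul, sub_eq_add_neg,
          Real.rpow_add (by positivity), Real.rpow_one, Nat.add_sub_cancel]
        ring
    _ ≤ _ := Finset.sum_le_sum h1

/-- The smallest term of a sequence is controlled by a weighted sum of squares. -/
theorem inf'_le_of_sum_stepsize_mul_sq_le (hθ : 0 < θ) (hθ' : θ < 1) {u : ℕ → ℝ}
    (hu : ∀ k, 0 ≤ u k) {C₀ a : ℝ} (ha : 0 ≤ a)
    (hs : ∀ N, ∑ k ∈ Finset.range N, stepsize θ k * u k ^ 2 ≤ C₀ * a ^ 2) {k : ℕ} (hk : 1 ≤ k)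
    (hC : 0 ≤ C₀) :
    (Finset.Icc 1 k).inf' (Finset.nonempty_Icc.2 hk) u ≤
      √(2 * C₀) * (a / (k : ℝ) ^ ((1 - θ) / 2)) := by
  set r := (Finset.Icc 1 k).inf' (Finset.nonempty_Icc.2 hk) u with hr
  have hk' : (0 : ℝ) < k := by exact_mod_cast hk
  have hr0 : 0 ≤ r := Finset.le_inf' _ _ fun i _ => hu i
  have h1 : r ^ 2 * ((k : ℝ) ^ (1 - θ) / 2) ≤ C₀ * a ^ 2 := by
    calc _ ≤ r ^ 2 * ∑ i ∈ Finset.Icc 1 k, stepsize θ i :=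
          mul_le_mul_of_nonneg_left (rpow_le_sum_stepsize hθ hθ' hk) (sq_nonneg r)
      _ ≤ ∑ i ∈ Finset.Icc 1 k, stepsize θ i * u i ^ 2 := by
          rw [Finset.mul_sum]
          refine Finset.sum_le_sum fun i hi => ?_
          rw [mul_comm]
          exact mul_le_mul_of_nonneg_left
            (pow_le_pow_left₀ hr0 (Finset.inf'_le u hi) 2) (stepsize_nonneg i)
      _ ≤ ∑ i ∈ Finset.range (k + 1), stepsize θ i * u i ^ 2 := by
          refine Finset.sum_le_sum_of_subset_of_nonneg (fun i hi => ?_)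
            fun i _ _ => mul_nonneg (stepsize_nonneg i) (sq_nonneg _)
          have := (Finset.mem_Icc.1 hi).2
          exact Finset.mem_range.2 (by omega)
      _ ≤ _ := hs _
  have hκ : ((k : ℝ) ^ ((1 - θ) / 2)) ^ 2 = (k : ℝ) ^ (1 - θ) := by
    rw [← Real.rpow_natCast, ← Real.rpow_mul hk'.le]
    norm_num
  refine (pow_le_pow_iff_left₀ hr0 (by positivity) two_ne_zero).1 ?_
  rw [mul_pow, Real.sq_sqrt (by positivity), div_pow, hκ, mul_div_assoc', le_div_iff₀ (by positivity)]
  linarith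

end Stepsize

end DMGD

end

theorem theorem1 (m M : ℕ) (θ : ℝ) (hθ : 1 / 2 < θ) (hθ' : θ < 1) (B L Δ : ℝ) :
    -- the constant depends only on the numbers of nodes and samples, `θ`, `B`, `L` and `Δ`
    ∃ C : ℝ, ∀ (n : ℕ) (f : Fin m → Fin M → DMGD.Param n → ℝ) (x₀ : DMGD.Param n),
      (∀ v s, Differentiable ℝ (f v s)) →
      -- lower bounded losses; `Δ` is any bound of the initial gap
      (∀ v, BddBelow (Set.range (DMGD.localLoss f v))) →
      (∀ y, DMGD.objective f x₀ - DMGD.objective f y ≤ Δ) →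
      -- bounded and Lipschitz gradients
      (∀ v s x, ‖gradient (f v s) x‖ ≤ B) →
      (∀ v s x y, ‖gradient (f v s) x - gradient (f v s) y‖ ≤ L * ‖x - y‖) →
      -- connected network and mixing matrix
      ∀ (G : SimpleGraph (Fin m)) (W : Matrix (Fin m) (Fin m) ℝ),
      G.Connected → DMGD.IsMixingMatrix G W →
      -- transition matrix of the Markov chains, with the uniform stationary distribution
      ∀ (H : Matrix (Fin M) (Fin M) ℝ),
      DMGD.IsTransitionMatrix H → DMGD.IsIrreducible H → DMGD.IsAperiodic H →
      DMGD.IsStationary H (fun _ => 1 / (M : ℝ)) →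
      ∀ (Ω : Type*) [MeasurableSpace Ω] (μ : Measure Ω) [IsProbabilityMeasure μ]
        (j : ℕ → Fin m → Ω → Fin M), DMGD.IsMarkovSampling μ H j →
      Tendsto (fun k => DMGD.expGradNorm μ W θ f x₀ j k) atTop (𝓝 0) ∧
      DMGD.mixingRate H ∈ Set.Ico (0 : ℝ) 1 ∧
      ∀ (k : ℕ) (hk : 1 ≤ k),
        (Finset.Icc 1 k).inf' (Finset.nonempty_Icc.2 hk)
            (fun i => DMGD.expGradNorm μ W θ f x₀ j i) ≤
          C * ((1 / Real.log (1 / DMGD.mixingRate H)) * (1 / (1 - DMGD.secondModulus W)) /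
            (k : ℝ) ^ ((1 - θ) / 2)) := by
  have hθ0 : 0 < θ := by linarith
  let S := ∑' k, DMGD.stepsize θ k ^ 2
  let C₀ := Δ + (|L| * B ^ 2 + 2 * |L| * B ^ 2 * (28 * M + 4)) * S +
    B ^ 2 * |L| * ((28 * m + 4) * S) + 2 * (B ^ 2 * (28 * M + 4))
  refine ⟨√(2 * C₀), ?_⟩
  intro n f x₀ hdiff _ hΔ hB hL G W hG hW H hH hirr hap hstat Ω _ μ _ j hj
  have hm : 0 < m := Fin.pos_iff_nonempty.2 hG.nonempty
  obtain ⟨ω₀⟩ : Nonempty Ω := nonempty_of_isProbabilityMeasure μ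
  have hM : 0 < M := Fin.pos (j 0 ⟨0, hm⟩ ω₀)
  have hf : DMGD.IsRegular f B |L| :=
    { diff := hdiff
      bound := hB
      lip := fun v s x y =>
        (hL v s x y).trans (mul_le_mul_of_nonneg_right (le_abs_self L) (norm_nonneg _))
      bound_nonneg := (norm_nonneg _).trans (hB ⟨0, hm⟩ ⟨0, hM⟩ x₀)
      lip_nonneg := abs_nonneg L }
  have hΔ0 : 0 ≤ Δ := by simpa using hΔ x₀
  have hWt := DMGD.isTransitionMatrix_of_isMixingMatrix hW
  have hWs := DMGD.isStationary_of_isMixingMatrix hW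
  have hWd := DMGD.mem_doublyStochastic_of_isStationary hWt hWs
  have hHd := DMGD.mem_doublyStochastic_of_isStationary hH hstat
  have hρW : DMGD.secondModulus W < 1 := DMGD.secondModulus_lt_one hm hWt
    (DMGD.isIrreducible_of_isMixingMatrix hG hW) (DMGD.isAperiodic_of_isMixingMatrix hW) hWs
  have hρH : DMGD.secondModulus H < 1 := DMGD.secondModulus_lt_one hM hH hirr hap hstat
  have hρW0 : 0 ≤ DMGD.secondModulus W := NNReal.coe_nonneg _
  have hρH0 : 0 ≤ DMGD.secondModulus H := NNReal.coe_nonneg _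
  have hrate : DMGD.mixingRate H ∈ Set.Ico (0 : ℝ) 1 := by
    constructor <;> rw [DMGD.mixingRate] <;> linarith
  obtain ⟨P, hP, hPK⟩ := DMGD.exists_poisson_solution hM hHd hρH
  have hS2 : Summable fun k => DMGD.stepsize θ k ^ 2 :=
    DMGD.summable_stepsize_pow (by push_cast; linarith)
  have hS : ∀ N, ∑ k ∈ Finset.range N, DMGD.stepsize θ k ^ 2 ≤ S := fun N =>
    hS2.sum_le_tsum _ fun _ _ => sq_nonneg _
  have hS0 : 0 ≤ S := tsum_nonneg fun _ => sq_nonneg _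
  have hsum := hf.sum_mul_sq_le (x₀ := x₀) DMGD.stepsize_nonneg (DMGD.stepsize_antitone hθ0) hS
    hm hM hWd (DMGD.sum_sum_row_abs_le hm hWd hρW) hP hPK hj hΔ
  have hu0 : ∀ k, 0 ≤ DMGD.expGradNorm μ W θ f x₀ j k := fun k =>
    integral_nonneg fun _ => norm_nonneg _
  refine ⟨?_, hrate, fun k hk => ?_⟩
  · refine DMGD.tendsto_zero_of_sum_mul_sq DMGD.stepsize_nonneg (DMGD.not_summable_stepsize hθ')
      (DMGD.summable_stepsize_pow (by push_cast; linarith)) hu0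
      (hf.abs_integral_succ_sub_le DMGD.stepsize_nonneg hm hM hWd hj) ?_
    exact summable_of_sum_range_le
      (fun k => mul_nonneg (DMGD.stepsize_nonneg k) (sq_nonneg _)) hsum
  · have hlog0 : 0 < Real.log (1 / DMGD.mixingRate H) := by
      have : 0 < DMGD.mixingRate H := by rw [DMGD.mixingRate]; linarith
      exact Real.log_pos (by rw [lt_div_iff₀ this]; linarith [hrate.2])
    have hlog := DMGD.log_one_div_mixingRate_le hρH
    set b := 1 / (1 - DMGD.secondModulus W) with hb
    set a := 1 / Real.log (1 / DMGD.mixingRate H) with ha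
    have hδ : 1 / (1 - DMGD.secondModulus H) ≤ a := one_div_le_one_div_of_le hlog0 hlog
    have hb1 : 1 ≤ b := by rw [hb, le_div_iff₀ (by linarith)]; linarith
    have ha1 : 1 ≤ a := le_trans (by rw [le_div_iff₀ (by linarith)]; linarith) hδ
    have hC : 0 ≤ C₀ := by positivity
    refine DMGD.inf'_le_of_sum_stepsize_mul_sq_le hθ0 hθ' hu0 (by positivity) (fun N => ?_) hk hC
    refine (hsum N).trans ?_
    have hγ0 : DMGD.stepsize θ 0 = 1 := by simp [DMGD.stepsize]
    have hKH : (28 * M + 4) / (1 - DMGD.secondModulus H) ^ 2 ≤ (28 * M + 4) * (a * b) ^ 2 := by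
      rw [div_eq_mul_one_div, ← one_div_pow]
      gcongr
      exact hδ.trans (le_mul_of_one_le_right (by linarith) hb1)
    have hKW : (28 * m + 4) / (1 - DMGD.secondModulus W) ^ 2 ≤ (28 * m + 4) * (a * b) ^ 2 := by
      rw [div_eq_mul_one_div, ← one_div_pow, ← hb]
      gcongr
      nlinarith
    have hab : 1 ≤ (a * b) ^ 2 := one_le_pow₀ (by nlinarith)
    calc _ ≤ Δ * (a * b) ^ 2 + (|L| * B ^ 2 * (a * b) ^ 2 +
          2 * |L| * B ^ 2 * ((28 * M + 4) * (a * b) ^ 2)) * S +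
          B ^ 2 * |L| * ((28 * m + 4) * (a * b) ^ 2 * S) +
          2 * (B ^ 2 * ((28 * M + 4) * (a * b) ^ 2)) * 1 := by
          rw [hγ0]
          refine add_le_add (add_le_add (add_le_add (le_mul_of_one_le_right hΔ0 hab)
            (mul_le_mul_of_nonneg_right (add_le_add (le_mul_of_one_le_right (by positivity) hab)
              (mul_le_mul_of_nonneg_left hKH (by positivity))) hS0))
            (mul_le_mul_of_nonneg_left (mul_le_mul_of_nonneg_right hKW hS0) (by positivity))) ?_
          exact mul_le_mul_of_nonneg_right (mul_le_mul_of_nonneg_left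
            (mul_le_mul_of_nonneg_left hKH (sq_nonneg B)) two_pos.le) zero_le_one
      _ = _ := by ring
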